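/- **Setting.** Let $1\le k\le n$ and $\delta\ge 0$ be integers. A system consists of a set of readers, a totally ordered set of writers (together, the clients) and $n$ servers $s_1,\dots,s_n$, which run asynchronously and exchange messages over links with arbitrary delays. Let $\Phi=(\Phi_1,\dots,\Phi_n)$ be the encoder of an $[n,k]$ linear MDS code over a finite field, so that any $k$ of the coded elements $\Phi_1(v),\dots,\Phi_n(v)$ determine the value $v\in V$. Tags are pairs $(z,w)$ of a natural number and a writer, ordered lexicographically; $t_0$ is an initial tag and $v_0\in V$ the initial value. A client may crash at any time, for good, and invokes an operation only after all its earlier operations have completed (well-formedness). A server is active, crashed or in repair; initially all servers are active. A crash (from active or repair) erases its state, and messages reaching it while it is crashed are lost; an external repair event takes it from crashed to repair. In a *group-send* a process sends one message to each of the $n$ servers, one after the other, and it may crash in between. Responses are matched to the group-send that they answer. **Algorithm RADON-C.** Each server $s_i$ keeps a $List$ of pairs (tag, coded element), initially $\{(t_0,\Phi_i(v_0))\}$. Servers respond to requests only while active. - *write($v$)* by $w$: (get-tag) group-send a tag query, to which a server answers with the largest tag in its $List$; await responses from a majority of servers and let $t^*$ be the largest tag received. (put-data) Put $t_w=(t^*.z+1,w)$,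 group-send $(t_w,\Phi_i(v))$ to each $s_i$, and complete after $\lceil (3n+k)/4\rceil$ acks. A server that receives $(t,c)$ adds it to its $List$, retains the pairs with the $\delta+1$ highest tags, and sends an ack. - *read*: (get-data) group-send a list query, to which a server answers with its $List$; await $\lceil (n+k)/2\rceil$ lists, and select the largest tag $t_r$ whose value $v_r$ is decodable, i.e. $k$ of these lists contain the coded elements of $v_r$ with tag $t_r$. (put-data) Group-send $(t_r,\Phi_i(v_r))$ to each $s_i$, await $\lceil (3n+k)/4\rceil$ acks, and return $v_r$. - *repair* of $s_i$: group-send a list query, await $\lceil (n+k)/2\rceil$ lists, set the $List$ to the pairs $(t,\Phi_i(v))$ for the at most $\delta+1$ highest tags among all decodable pairs $(t,v)$, and become active. For a write $\pi$, $tag(\pi)$ is the tag $t_w$ it uses in put-data. **Condition N1 with parameter $\alpha$.** For every group-send that is executed in full there is a set $S_\alpha$ of $\lceil\alpha n\rceil$ servers all of which effectively consume (receive and process) their messages, and all of which are active from the start of the group-send until the last of them has done so. **Concurrency.** A read is *valid* if its reader does not crash before it has received the $\lceil (n+k)/2\rceil$ lists; let $T_2$ be the time when it has received them. A repair is *valid*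 if its server does not crash again during the repair; let $T_2$ be the time of its completion. The writes *concurrent* with a valid read or repair are the writes $\lambda$ that start before $T_2$ and have a tag that is larger than $tag(\sigma)$ for every write $\sigma$ that completes before the read or repair is initiated. **Theorem.** Let $\alpha\ge\frac{3n+k}{4n}$. Consider any (finite or infinite) execution of RADON-C that satisfies N1 with parameter $\alpha$ and in which at most $\delta$ writes are concurrent with any valid read or repair. Then the execution is atomic (linearizable): for all complete and some of the incomplete read and write operations (with suitable results for the incomplete reads) there are distinct serialization points, each lying between the invocation and the response (if any) of its operation, such that every one of these reads returns the value of the last of these writes serialized before it, or $v_0$ if there is none. -/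

import Mathlib

namespace RadonC

/-! ### Linear MDS codes -/

/-- An `[n, k]` linear MDS code over the field `F`, together with a representation of the values in
`V`: a value is divided into `k` elements, each a word of symbols of `F` indexed by the stripes
`ι`, and the stripes are encoded individually. -/
structure LinearMDSCode (F : Type*) [Field F] (n k : ℕ) (ι V : Type*) where
  /-- generator matrix -/
  gen : Matrix (Fin k) (Fin n) F
  /-- any `k` of the `n` coded symbols determine the `k` message symbols -/
  mds : ∀ S : Finset (Fin n), S.card = k →
    Function.Injective fun (x : Fin k → F) (i : S) => Matrix.vecMul x gen i
  /-- the `k` elements into which a value is divided -/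
  elems : V → Fin k → ι → F
  elems_injective : Function.Injective elems

/-- The encoder: `code.encode v i` is the coded element `Φ_i(v)` of server `i`. -/
def LinearMDSCode.encode {F : Type*} [Field F] {n k : ℕ} {ι V : Type*}
    (code : LinearMDSCode F n k ι V) (v : V) (i : Fin n) : ι → F :=
  fun stripe => Matrix.vecMul (fun j => code.elems v j stripe) code.gen i

/-! ### Tags, messages, local states -/

/-- Tags `(z, w)`, ordered lexicographically. -/
abbrev Tag (W : Type*) := ℕ ×ₗ W

/-- Contents of a server's `List`: a set of (tag, coded-element) pairs. -/
abbrev CodedList (W C : Type*) := Set (Tag W × C)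

/-- Process identifiers: writers, readers and the `n` servers. -/
inductive Proc (n : ℕ) (W R : Type*) where
  | writer (w : W)
  | reader (r : R)
  | server (s : Fin n)

/-- Contents of the messages sent by group-send. -/
inductive Request (W C : Type*) where
  | queryTag
  | queryList
  | codeElement (t : Tag W) (c : C)
  | repairList

/-- Contents of the responses of the servers. -/
inductive Response (W C : Type*) where
  | tag (t : Tag W)
  | list (L : CodedList W C)
  | ack

/-- Messages. Each carries the unique identifier `g` of the group-send operation it belongs to, so
that a process can tell which of its requests a response answers. The identifier of a group-send
is the index of the step of the execution at which that group-send is started. Two messages that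
are ever sent in one execution are thus different, and sets suffice to describe channels. -/
inductive Message (n : ℕ) (W R C : Type*) where
  | req (g : ℕ) (src : Proc n W R) (dst : Fin n) (m : Request W C)
  | resp (g : ℕ) (src : Fin n) (dst : Proc n W R) (m : Response W C)

/-- State of a writer. The operation in progress is identified by the index `o` of its invocation
step, which also starts its first group-send; `g` identifies the group-send of put-data;
`got` records the responses received in get-tag, `acks` the servers whose ack was received. -/
inductive WriterState (n : ℕ) (W V : Type*) where
  | idle
  | getTag (o : ℕ) (v : V) (got : Fin n → Option (Tag W))
  | putData (o g : ℕ) (acks : Finset (Fin n))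
  | crashed

/-- State of a reader (see `WriterState`); `v` is the value that is going to be returned. -/
inductive ReaderState (n : ℕ) (W V C : Type*) where
  | idle
  | getData (o : ℕ) (got : Fin n → Option (CodedList W C))
  | putData (o g : ℕ) (v : V) (acks : Finset (Fin n))
  | crashed

/-- State of a server. A repair operation is identified by the index `o` of its init-repair step;
`got` records the lists received so far. A crashed server has lost all its data. -/
inductive ServerState (n : ℕ) (W C : Type*) where
  | active (L : CodedList W C)
  | crashed
  | repair (o : ℕ) (got : Fin n → Option (CodedList W C))

/-- Global states. `outbox p` holds the messages of the current group-send of `p` that are still to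
be sent; `net` holds the messages in transit. -/
structure State (n : ℕ) (W R V C : Type*) where
  writers : W → WriterState n W V
  readers : R → ReaderState n W V C
  servers : Fin n → ServerState n W C
  outbox : Proc n W R → Set (Message n W R C)
  net : Set (Message n W R C)

/-- Parameters of the algorithm: the code dimension `k`, the concurrency parameter `δ`, the encoder
`Φ`, and the initial tag and value. -/
structure Params (n : ℕ) (W V C : Type*) where
  k : ℕ
  δ : ℕ
  Φ : V → Fin n → C
  t₀ : Tag W
  v₀ : V

/-! ### Quorums, pruning, decoding -/

/-- The least number of servers that form a majority. -/
def majority (n : ℕ) : ℕ := n / 2 + 1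

/-- `⌈(n + k) / 2⌉`, the number of lists awaited in a read or a repair. -/
def listQuorum (n k : ℕ) : ℕ := ⌈((n : ℚ) + k) / 2⌉₊

/-- `⌈(3 n + k) / 4⌉`, the number of acks awaited in put-data. -/
def ackQuorum (n k : ℕ) : ℕ := ⌈(3 * (n : ℚ) + k) / 4⌉₊

/-- The servers whose response has been recorded. -/
def heard {n : ℕ} {α : Type*} (got : Fin n → Option α) : Finset (Fin n) :=
  Finset.univ.filter fun s => (got s).isSome

/-- Retain the pairs for the `δ + 1` highest tags: those pairs above whose tag there are at most
`δ` other tags. -/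
def prune {W C : Type*} [LinearOrder W] (δ : ℕ) (L : CodedList W C) : CodedList W C :=
  {p ∈ L | {t ∈ Prod.fst '' L | p.1 < t}.encard ≤ δ}

/-- The (tag, value) pair `(t, v)` is decodable from the received lists: some `k` of these lists
contain the coded elements of `v` with tag `t`. -/
def Decodable {n : ℕ} {W V C : Type*} (P : Params n W V C)
    (got : Fin n → Option (CodedList W C)) (t : Tag W) (v : V) : Prop :=
  ∃ S : Finset (Fin n), S.card = P.k ∧ ∀ s ∈ S, ∃ L, got s = some L ∧ (t, P.Φ v s) ∈ L

/-- The response `t` of an active server with list `L` to a query for its highest tag (`t₀` is the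
conventional answer if the list is empty). -/
def MaxTag {W C : Type*} [LinearOrder W] (t₀ : Tag W) (L : CodedList W C) (t : Tag W) : Prop :=
  IsGreatest (Prod.fst '' L) t ∨ (L = ∅ ∧ t = t₀)

/-- Effective consumption of the request `m` by the active server `s` with list `L`: its new list is
`L'` and it sends the response `a`. -/
inductive Serve {n : ℕ} {W V C : Type*} [LinearOrder W] (P : Params n W V C) (s : Fin n)
    (L : CodedList W C) : Request W C → CodedList W C → Response W C → Prop
  | getTagResp (t : Tag W) : MaxTag P.t₀ L t → Serve P s L .queryTag L (.tag t)
  | getDataResp : Serve P s L .queryList L (.list L)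
  | putDataResp (t : Tag W) (c : C) :
      Serve P s L (.codeElement t c) (prune P.δ (L ∪ {(t, c)})) .ack
  | initRepairResp : Serve P s L .repairList L (.list L)

/-! ### The transition relation -/

/-- The messages of `group-send [m 1, …, m n]` of process `p` with identifier `g`. -/
def groupSend {n : ℕ} {W R C : Type*} (g : ℕ) (p : Proc n W R) (m : Fin n → Request W C) :
    Set (Message n W R C) :=
  Set.range fun s => Message.req g p s (m s)

/-- Actions. The argument `o` of an action is the identifier of the operation concerned, `g` the
identifier of the group-send concerned. -/
inductive Action (n : ℕ) (W R V : Type*) where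
  | invokeWrite (w : W) (v : V)
  | writePutData (w : W) (o : ℕ) (t : Tag W)
  | respondWrite (w : W) (o : ℕ)
  | invokeRead (r : R)
  | readPutData (r : R) (o : ℕ) (t : Tag W)
  | respondRead (r : R) (o : ℕ) (v : V)
  | crashWriter (w : W)
  | crashReader (r : R)
  | crashServer (s : Fin n)
  | initRepair (s : Fin n)
  | endRepair (s : Fin n) (o : ℕ)
  /-- a process sends its message of group-send `g` to server `s` -/
  | send (g : ℕ) (s : Fin n)
  /-- the active server `s` effectively consumes its message of group-send `g` -/
  | consume (g : ℕ) (s : Fin n)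
  /-- a message of group-send `g` reaches server `s` while `s` is not active -/
  | miss (g : ℕ) (s : Fin n)
  /-- a process receives the response of server `s` to its group-send `g` -/
  | receive (g : ℕ) (s : Fin n)
  | stutter

/-- The initial state. -/
def initial {n : ℕ} {W V C : Type*} (P : Params n W V C) (R : Type*) : State n W R V C where
  writers := fun _ => .idle
  readers := fun _ => .idle
  servers := fun s => .active {(P.t₀, P.Φ P.v₀ s)}
  outbox := fun _ => ∅
  net := ∅

open scoped Classical in
/-- `Step P i x a y`: the action `a`, taken as step number `i` of an execution, leads from the state
`x` to the state `y`. A process that executes a group-send first sends its `n` messages one after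
the other (and may crash in between), and only then receives responses. Responses that are no
longer awaited have no effect, so that their reception is not modelled. -/
inductive Step {n : ℕ} {W R V C : Type*} [LinearOrder W] (P : Params n W V C) (i : ℕ)
    (x : State n W R V C) : Action n W R V → State n W R V C → Prop
  -- write, get-tag phase
  | invokeWrite (w : W) (v : V) (hidle : x.writers w = .idle) :
      Step P i x (.invokeWrite w v)
        { x with
          writers := Function.update x.writers w (.getTag i v fun _ => none)
          outbox := Function.update x.outbox (.writer w)
            (groupSend i (.writer w) fun _ => .queryTag) }
  | receiveTag (w : W) (o : ℕ) (v : V) (got : Fin n → Option (Tag W)) (s : Fin n) (t : Tag W)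
      (hst : x.writers w = .getTag o v got) (hout : x.outbox (.writer w) = ∅)
      (hwait : (heard got).card < majority n)
      (hmsg : Message.resp o s (.writer w) (.tag t) ∈ x.net) :
      Step P i x (.receive o s)
        { x with
          writers := Function.update x.writers w (.getTag o v (Function.update got s (some t)))
          net := x.net \ {Message.resp o s (.writer w) (.tag t)} }
  -- write, put-data phase
  | writePutData (w : W) (o : ℕ) (v : V) (got : Fin n → Option (Tag W)) (tmax : Tag W)
      (hst : x.writers w = .getTag o v got) (hquorum : (heard got).card = majority n)
      (hmax : IsGreatest {t | ∃ s, got s = some t} tmax) :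
      Step P i x (.writePutData w o (toLex ((ofLex tmax).1 + 1, w)))
        { x with
          writers := Function.update x.writers w (.putData o i ∅)
          outbox := Function.update x.outbox (.writer w)
            (groupSend i (.writer w) fun s =>
              .codeElement (toLex ((ofLex tmax).1 + 1, w)) (P.Φ v s)) }
  | receiveWriteAck (w : W) (o g : ℕ) (acks : Finset (Fin n)) (s : Fin n)
      (hst : x.writers w = .putData o g acks) (hout : x.outbox (.writer w) = ∅)
      (hwait : acks.card < ackQuorum n P.k)
      (hmsg : Message.resp g s (.writer w) .ack ∈ x.net) :
      Step P i x (.receive g s)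
        { x with
          writers := Function.update x.writers w (.putData o g (insert s acks))
          net := x.net \ {Message.resp g s (.writer w) .ack} }
  | respondWrite (w : W) (o g : ℕ) (acks : Finset (Fin n))
      (hst : x.writers w = .putData o g acks) (hquorum : acks.card = ackQuorum n P.k) :
      Step P i x (.respondWrite w o)
        { x with writers := Function.update x.writers w .idle }
  -- read, get-data phase
  | invokeRead (r : R) (hidle : x.readers r = .idle) :
      Step P i x (.invokeRead r)
        { x with
          readers := Function.update x.readers r (.getData i fun _ => none)
          outbox := Function.update x.outbox (.reader r)
            (groupSend i (.reader r) fun _ => .queryList) }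
  | receiveList (r : R) (o : ℕ) (got : Fin n → Option (CodedList W C)) (s : Fin n)
      (L : CodedList W C)
      (hst : x.readers r = .getData o got) (hout : x.outbox (.reader r) = ∅)
      (hwait : (heard got).card < listQuorum n P.k)
      (hmsg : Message.resp o s (.reader r) (.list L) ∈ x.net) :
      Step P i x (.receive o s)
        { x with
          readers := Function.update x.readers r (.getData o (Function.update got s (some L)))
          net := x.net \ {Message.resp o s (.reader r) (.list L)} }
  -- read, put-data phase
  | readPutData (r : R) (o : ℕ) (got : Fin n → Option (CodedList W C)) (t : Tag W) (v : V)
      (hst : x.readers r = .getData o got) (hquorum : (heard got).card = listQuorum n P.k)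
      (hdec : Decodable P got t v) (hmax : ∀ t' v', Decodable P got t' v' → t' ≤ t) :
      Step P i x (.readPutData r o t)
        { x with
          readers := Function.update x.readers r (.putData o i v ∅)
          outbox := Function.update x.outbox (.reader r)
            (groupSend i (.reader r) fun s => .codeElement t (P.Φ v s)) }
  | receiveReadAck (r : R) (o g : ℕ) (v : V) (acks : Finset (Fin n)) (s : Fin n)
      (hst : x.readers r = .putData o g v acks) (hout : x.outbox (.reader r) = ∅)
      (hwait : acks.card < ackQuorum n P.k)
      (hmsg : Message.resp g s (.reader r) .ack ∈ x.net) :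
      Step P i x (.receive g s)
        { x with
          readers := Function.update x.readers r (.putData o g v (insert s acks))
          net := x.net \ {Message.resp g s (.reader r) .ack} }
  | respondRead (r : R) (o g : ℕ) (v : V) (acks : Finset (Fin n))
      (hst : x.readers r = .putData o g v acks) (hquorum : acks.card = ackQuorum n P.k) :
      Step P i x (.respondRead r o v)
        { x with readers := Function.update x.readers r .idle }
  -- crashes of clients, at any point and for good
  | crashWriter (w : W) :
      Step P i x (.crashWriter w)
        { x with
          writers := Function.update x.writers w .crashed
          outbox := Function.update x.outbox (.writer w) ∅ }
  | crashReader (r : R) :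
      Step P i x (.crashReader r)
        { x with
          readers := Function.update x.readers r .crashed
          outbox := Function.update x.outbox (.reader r) ∅ }
  -- crash of a server that is active or in repair
  | crashServer (s : Fin n) (hst : x.servers s ≠ .crashed) :
      Step P i x (.crashServer s)
        { x with
          servers := Function.update x.servers s .crashed
          outbox := Function.update x.outbox (.server s) ∅ }
  -- repair
  | initRepair (s : Fin n) (hst : x.servers s = .crashed) :
      Step P i x (.initRepair s)
        { x with
          servers := Function.update x.servers s (.repair i fun _ => none)
          outbox := Function.update x.outbox (.server s)
            (groupSend i (.server s) fun _ => .repairList) }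
  | receiveRepairList (s : Fin n) (o : ℕ) (got : Fin n → Option (CodedList W C)) (s' : Fin n)
      (L : CodedList W C)
      (hst : x.servers s = .repair o got) (hout : x.outbox (.server s) = ∅)
      (hwait : (heard got).card < listQuorum n P.k)
      (hmsg : Message.resp o s' (.server s) (.list L) ∈ x.net) :
      Step P i x (.receive o s')
        { x with
          servers := Function.update x.servers s (.repair o (Function.update got s' (some L)))
          net := x.net \ {Message.resp o s' (.server s) (.list L)} }
  | endRepair (s : Fin n) (o : ℕ) (got : Fin n → Option (CodedList W C))
      (hst : x.servers s = .repair o got) (hquorum : (heard got).card = listQuorum n P.k) :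
      Step P i x (.endRepair s o)
        { x with
          servers := Function.update x.servers s
            (.active (prune P.δ {p | ∃ v, Decodable P got p.1 v ∧ p.2 = P.Φ v s})) }
  -- communication
  | send (p : Proc n W R) (g : ℕ) (s : Fin n) (m : Request W C)
      (hmsg : Message.req g p s m ∈ x.outbox p) :
      Step P i x (.send g s)
        { x with
          outbox := Function.update x.outbox p (x.outbox p \ {Message.req g p s m})
          net := x.net ∪ {Message.req g p s m} }
  | consume (p : Proc n W R) (g : ℕ) (s : Fin n) (m : Request W C) (L L' : CodedList W C)
      (a : Response W C) (hmsg : Message.req g p s m ∈ x.net)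
      (hst : x.servers s = .active L) (hserve : Serve P s L m L' a) :
      Step P i x (.consume g s)
        { x with
          servers := Function.update x.servers s (.active L')
          net := (x.net \ {Message.req g p s m}) ∪ {Message.resp g s p a} }
  | miss (p : Proc n W R) (g : ℕ) (s : Fin n) (m : Request W C)
      (hmsg : Message.req g p s m ∈ x.net) (hst : ∀ L, x.servers s ≠ .active L) :
      Step P i x (.miss g s)
        { x with net := x.net \ {Message.req g p s m} }
  | stutter : Step P i x .stutter x

/-! ### Executions -/

/-- Executions. A finite execution is represented by letting it stutter forever at its end.
Well-formedness is built in: a client invokes an operation only when it is idle. -/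
structure Execution {n : ℕ} {W V C : Type*} [LinearOrder W] (P : Params n W V C) (R : Type*) where
  state : ℕ → State n W R V C
  act : ℕ → Action n W R V
  init : state 0 = initial P R
  step : ∀ i, Step P i (state i) (act i) (state (i + 1))

namespace Execution

variable {n : ℕ} {W R V C : Type*} [LinearOrder W] {P : Params n W V C}

/-- `o` is a write operation with value `v`. Operations are identified by the index of their
invocation step. -/
def IsWrite (e : Execution P R) (o : ℕ) (v : V) : Prop := ∃ w, e.act o = .invokeWrite w v

/-- `o` is a read operation. -/
def IsRead (e : Execution P R) (o : ℕ) : Prop := ∃ r, e.act o = .invokeRead r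

/-- The write operation `o` completes at step `j`. -/
def WriteCompletes (e : Execution P R) (o j : ℕ) : Prop := ∃ w, e.act j = .respondWrite w o

/-- The read operation `o` completes at step `j` and returns `v`. -/
def ReadCompletes (e : Execution P R) (o j : ℕ) (v : V) : Prop := ∃ r, e.act j = .respondRead r o v

/-- `tag(o) = t` for the write operation `o`: the tag that the writer uses in put-data. -/
def WriteTag (e : Execution P R) (o : ℕ) (t : Tag W) : Prop := ∃ j w, e.act j = .writePutData w o t

/-- Server `s` is in the active state at time `i`. -/
def Active (e : Execution P R) (s : Fin n) (i : ℕ) : Prop := ∃ L, (e.state i).servers s = .active L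

/-- Network stability condition N1 with parameter `α`: for every group-send operation `g` that is
executed in full there is a set `Sα` of `⌈α n⌉` servers that effectively consume their messages
(`τ s` is the step at which `s` does so) and that are all active from the start of the
group-send until the last of them has completed this consumption. -/
def N1 (e : Execution P R) (α : ℝ) : Prop :=
  ∀ g, (∀ s, ∃ j, e.act j = .send g s) →
    ∃ (Sα : Finset (Fin n)) (τ : Fin n → ℕ), Sα.card = ⌈α * n⌉₊ ∧
      (∀ s ∈ Sα, e.act (τ s) = .consume g s) ∧
      ∀ s ∈ Sα, ∀ s' ∈ Sα, ∀ i, g ≤ i → i ≤ τ s' + 1 → e.Active s i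

/-- At time `i` the reader that executes the read `o` is in its get-data phase and has received all
the `⌈(n + k) / 2⌉` lists that it awaits. -/
def ReadHasLists (e : Execution P R) (o i : ℕ) : Prop :=
  ∃ r got, (e.state i).readers r = .getData o got ∧ (heard got).card = listQuorum n P.k

/-- `o` is a valid read, and its reader has received all awaited lists for the first time at `T₂`. -/
def ValidRead (e : Execution P R) (o T₂ : ℕ) : Prop :=
  e.IsRead o ∧ IsLeast {i | e.ReadHasLists o i} T₂

/-- `o` is a valid repair (no further crash occurs in it), which completes at `T₂`. -/
def ValidRepair (e : Execution P R) (o T₂ : ℕ) : Prop :=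
  ∃ s, e.act o = .initRepair s ∧ e.act T₂ = .endRepair s o

/-- The writes concurrent with a valid read or repair that is initiated at `T₁` and has the endpoint
`T₂`: the writes that start before `T₂` and whose tag is larger than the tags of all the writes
that complete before `T₁`. -/
def concurrentWrites (e : Execution P R) (T₁ T₂ : ℕ) : Set ℕ :=
  {l | (∃ v, e.IsWrite l v) ∧ l < T₂ ∧ ∃ t, e.WriteTag l t ∧
    ∀ o j t', e.WriteCompletes o j → j < T₁ → e.WriteTag o t' → t' < t}

/-- At most `d` writes are concurrent with any valid read or repair. -/
def ConcurrencyAtMost (e : Execution P R) (d : ℕ) : Prop :=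
  ∀ T₁ T₂, e.ValidRead T₁ T₂ ∨ e.ValidRepair T₁ T₂ → (e.concurrentWrites T₁ T₂).encard ≤ d

/-- Atomicity of an execution, as a read/write object with initial value `P.v₀`. There are a set `A`
of operations, namely all the complete ones and some of the incomplete ones, a choice of results
`ret` of the reads in `A` that agrees with the results of the complete reads, and distinct
serialization points `pt o` of the operations `o` in `A`, each after the invocation and before the
response (if any) of `o`, such that each read in `A` returns the value of the last write in `A`
serialized before it, and the initial value if there is none. -/
def Atomic (e : Execution P R) : Prop :=
  ∃ (A : Set ℕ) (ret : ℕ → V) (pt : ℕ → ℝ),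
    (∀ o ∈ A, (∃ v, e.IsWrite o v) ∨ e.IsRead o) ∧
    (∀ o j, e.WriteCompletes o j → o ∈ A) ∧
    (∀ o j v, e.ReadCompletes o j v → o ∈ A ∧ ret o = v) ∧
    Set.InjOn pt A ∧
    (∀ o ∈ A, (o : ℝ) < pt o) ∧
    (∀ o ∈ A, ∀ j : ℕ, (e.WriteCompletes o j ∨ ∃ v, e.ReadCompletes o j v) → pt o < j) ∧
    ∀ o ∈ A, e.IsRead o →
      ((∀ o' ∈ A, (∃ v, e.IsWrite o' v) → pt o < pt o') ∧ ret o = P.v₀) ∨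
      (∃ o' ∈ A, e.IsWrite o' (ret o) ∧ pt o' < pt o ∧
        ∀ o'' ∈ A, (∃ v, e.IsWrite o'' v) → pt o'' ≤ pt o' ∨ pt o < pt o'')

end Execution

end RadonC

/-! Everything rests on the trace left by a put-data phase with tag `t` that has gathered its acks.
The acknowledging servers and the set of condition N1 each number at least (3n+k)/4, so they share a
set `G` of at least (n+k)/2 servers. All of `G` consumed their coded elements before the acks were
complete, and each stayed active from its own consumption until the last one, at step `T`. This is
an `Anchor`. The set `G` has at least k servers in common with the senders of any ⌈(n+k)/2⌉ lists,
and at least one with any majority.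

A server of `G` may crash later, but a repair of it then starts after `T` and hence reads lists of
`G` that already had the element added. By induction over time, every active server of `G` keeps its
element as long as at most δ larger tags are in use (`Anchor.mem`). To get such a bound for a read
or repair, one passes to the largest tag among `t` and the tags of the writes completed before it
starts. That tag has an anchor too, and every larger tag in use belongs to a concurrent write, so it
is decodable (`Anchor.exists_decodable`). Consequently a later read uses a tag at least `t`
(`Anchor.le_readTag`). Active servers of `G` keep some tag at least `t` even across repairs
(`Anchor.exists_ge`), so a later write uses a strictly larger tag (`Anchor.lt_writeTag`).

It follows that tags determine writes (`WriteTag.injective`). Every stored element then encodes the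
value written with its tag, and by the MDS property a read returns exactly that value
(`ReadCompletes.hasValue`). Operations are serialized by tag, a write before the reads of its tag,
and these reads by invocation. The tag inequalities make this order compatible with real time and
give each operation finitely many predecessors, so that real-valued points can be chosen even in an
infinite execution. -/

namespace RadonC

variable {n : ℕ} {W R V C : Type*} [LinearOrder W] {P : Params n W V C}

/-! ### Inversion of steps -/

section Step

variable {i : ℕ} {x y : State n W R V C} {a : Action n W R V}

theorem eq_some_or_eq_of_update {α : Type*} {got : Fin n → Option α} {s s' : Fin n} {a b : α}
    (h : Function.update got s (some a) s' = some b) : got s' = some b ∨ (s' = s ∧ b = a) := by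
  by_cases hs : s' = s
  · subst hs
    simp at h
    exact .inr ⟨rfl, h.symm⟩
  · rw [Function.update_of_ne hs] at h
    exact .inl h

theorem Step.writer_getTag (h : Step P i x a y) {w : W} {o : ℕ} {v : V}
    {got : Fin n → Option (Tag W)} (hy : y.writers w = .getTag o v got) :
    (∃ got', x.writers w = .getTag o v got' ∧ ∀ s t, got s = some t →
      got' s = some t ∨ Message.resp o s (.writer w) (.tag t) ∈ x.net) ∨
    (o = i ∧ a = .invokeWrite w v ∧ got = fun _ => none) := by
  cases h
  case receiveTag w' o' v' got' s' t' hst hout hwait hmsg =>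
    by_cases hw : w = w'
    · subst hw
      simp only [Function.update_self, WriterState.getTag.injEq] at hy
      obtain ⟨rfl, rfl, rfl⟩ := hy
      refine .inl ⟨got', hst, fun s t h => ?_⟩
      rcases eq_some_or_eq_of_update h with h | ⟨rfl, rfl⟩
      exacts [.inl h, .inr hmsg]
    · simp [hw] at hy
      exact .inl ⟨got, hy, fun s t h => .inl h⟩
  all_goals try simp only [Function.update_apply] at hy
  all_goals grind

/-- A request leaves the outbox only by being sent, and an ack is accepted only when the outbox is
empty. Recording both facts shows later that an acknowledged group-send was executed in full, which
is the premise of N1. -/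
theorem Step.writer_putData (h : Step P i x a y) {w : W} {o g : ℕ} {acks : Finset (Fin n)}
    (hy : y.writers w = .putData o g acks) :
    (∃ acks', x.writers w = .putData o g acks' ∧
      (∀ s ∈ acks, s ∈ acks' ∨
        (x.outbox (.writer w) = ∅ ∧ Message.resp g s (.writer w) .ack ∈ x.net)) ∧
      ∀ g' s m, Message.req g' (.writer w) s m ∈ x.outbox (.writer w) →
        Message.req g' (.writer w) s m ∈ y.outbox (.writer w) ∨ a = .send g' s) ∨
    (g = i ∧ acks = ∅ ∧ ∃ t v got, a = .writePutData w o t ∧ x.writers w = .getTag o v got ∧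
      y.outbox (.writer w) = groupSend i (.writer w) fun s => .codeElement t (P.Φ v s)) := by
  cases h
  case writePutData w' o' v' got' tmax hst hquorum hmax =>
    by_cases hw : w = w'
    · subst hw
      simp only [Function.update_self, WriterState.putData.injEq] at hy
      obtain ⟨rfl, rfl, rfl⟩ := hy
      exact .inr ⟨rfl, rfl, _, v', got', rfl, hst, by simp⟩
    · simp [hw] at hy
      exact .inl ⟨acks, hy, fun s h => .inl h, fun _ _ _ h => .inl (by simpa [hw] using h)⟩
  case receiveWriteAck w' o' g' acks' s' hst hout hwait hmsg =>
    by_cases hw : w = w'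
    · subst hw
      simp only [Function.update_self, WriterState.putData.injEq] at hy
      obtain ⟨rfl, rfl, rfl⟩ := hy
      refine .inl ⟨acks', hst, fun s h => ?_, fun _ _ _ h => .inl h⟩
      rcases Finset.mem_insert.1 h with rfl | h
      exacts [.inr ⟨hout, hmsg⟩, .inl h]
    · simp [hw] at hy
      exact .inl ⟨acks, hy, fun s h => .inl h, fun _ _ _ h => .inl h⟩
  all_goals try simp only [Function.update_apply] at hy
  all_goals refine .inl ⟨acks, by grind, fun s h => .inl h, fun g' s m h => ?_⟩
  all_goals try simp only [Function.update_apply]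
  all_goals grind

theorem Step.reader_getData (h : Step P i x a y) {r : R} {o : ℕ}
    {got : Fin n → Option (CodedList W C)} (hy : y.readers r = .getData o got) :
    (∃ got', x.readers r = .getData o got' ∧
      (got = got' ∨ (heard got').card < listQuorum n P.k) ∧ ∀ s L, got s = some L →
        got' s = some L ∨ Message.resp o s (.reader r) (.list L) ∈ x.net) ∨
    (o = i ∧ a = .invokeRead r ∧ got = fun _ => none) := by
  cases h
  case receiveList r' o' got' s' L' hst hout hwait hmsg =>
    by_cases hr : r = r'
    · subst hr
      simp only [Function.update_self, ReaderState.getData.injEq] at hy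
      obtain ⟨rfl, rfl⟩ := hy
      refine .inl ⟨got', hst, .inr hwait, fun s t h => ?_⟩
      rcases eq_some_or_eq_of_update h with h | ⟨rfl, rfl⟩
      exacts [.inl h, .inr hmsg]
    · simp [hr] at hy
      exact .inl ⟨got, hy, .inl rfl, fun s t h => .inl h⟩
  all_goals try simp only [Function.update_apply] at hy
  all_goals grind

theorem Step.reader_putData (h : Step P i x a y) {r : R} {o g : ℕ} {v : V}
    {acks : Finset (Fin n)} (hy : y.readers r = .putData o g v acks) :
    (∃ acks', x.readers r = .putData o g v acks' ∧
      (∀ s ∈ acks, s ∈ acks' ∨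
        (x.outbox (.reader r) = ∅ ∧ Message.resp g s (.reader r) .ack ∈ x.net)) ∧
      ∀ g' s m, Message.req g' (.reader r) s m ∈ x.outbox (.reader r) →
        Message.req g' (.reader r) s m ∈ y.outbox (.reader r) ∨ a = .send g' s) ∨
    (g = i ∧ acks = ∅ ∧ ∃ t got, a = .readPutData r o t ∧ x.readers r = .getData o got ∧
      Decodable P got t v ∧
      y.outbox (.reader r) = groupSend i (.reader r) fun s => .codeElement t (P.Φ v s)) := by
  cases h
  case readPutData r' o' got' t' v' hst hquorum hdec hmax =>
    by_cases hr : r = r'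
    · subst hr
      simp only [Function.update_self, ReaderState.putData.injEq] at hy
      obtain ⟨rfl, rfl, rfl, rfl⟩ := hy
      exact .inr ⟨rfl, rfl, _, got', rfl, hst, hdec, by simp⟩
    · simp [hr] at hy
      exact .inl ⟨acks, hy, fun s h => .inl h, fun _ _ _ h => .inl (by simpa [hr] using h)⟩
  case receiveReadAck r' o' g' v' acks' s' hst hout hwait hmsg =>
    by_cases hr : r = r'
    · subst hr
      simp only [Function.update_self, ReaderState.putData.injEq] at hy
      obtain ⟨rfl, rfl, rfl, rfl⟩ := hy
      refine .inl ⟨acks', hst, fun s h => ?_, fun _ _ _ h => .inl h⟩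
      rcases Finset.mem_insert.1 h with rfl | h
      exacts [.inr ⟨hout, hmsg⟩, .inl h]
    · simp [hr] at hy
      exact .inl ⟨acks, hy, fun s h => .inl h, fun _ _ _ h => .inl h⟩
  all_goals try simp only [Function.update_apply] at hy
  all_goals refine .inl ⟨acks, by grind, fun s h => .inl h, fun g' s m h => ?_⟩
  all_goals try simp only [Function.update_apply]
  all_goals grind

theorem Step.server_active (h : Step P i x a y) {s : Fin n} {L' : CodedList W C}
    (hy : y.servers s = .active L') :
    (∃ L, x.servers s = .active L ∧ (L' = L ∨ ∃ p g t c,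
      Message.req g p s (.codeElement t c) ∈ x.net ∧ L' = prune P.δ (L ∪ {(t, c)}))) ∨
    (∃ o got, a = .endRepair s o ∧ x.servers s = .repair o got ∧
      (heard got).card = listQuorum n P.k ∧
      L' = prune P.δ {p | ∃ v, Decodable P got p.1 v ∧ p.2 = P.Φ v s}) := by
  cases h
  case consume p g s' m L L'' a hmsg hst hserve =>
    by_cases hs : s = s'
    · subst hs
      simp at hy
      subst hy
      refine .inl ⟨L, hst, ?_⟩
      cases hserve
      case putDataResp t c => exact .inr ⟨p, g, t, c, hmsg, rfl⟩
      all_goals exact .inl rfl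
    · simp [hs] at hy
      exact .inl ⟨L', hy, .inl rfl⟩
  case endRepair s' o got hst hquorum =>
    by_cases hs : s = s'
    · subst hs
      simp at hy
      exact .inr ⟨o, got, rfl, hst, hquorum, hy.symm⟩
    · simp [hs] at hy
      exact .inl ⟨L', hy, .inl rfl⟩
  all_goals try simp only [Function.update_apply] at hy
  all_goals grind

theorem Step.server_repair (h : Step P i x a y) {s : Fin n} {o : ℕ}
    {got : Fin n → Option (CodedList W C)} (hy : y.servers s = .repair o got) :
    (∃ got', x.servers s = .repair o got' ∧ ∀ s' L, got s' = some L →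
        got' s' = some L ∨ Message.resp o s' (.server s) (.list L) ∈ x.net) ∨
    (o = i ∧ a = .initRepair s ∧ got = fun _ => none) := by
  cases h
  case receiveRepairList r' o' got' s' L' hst hout hwait hmsg =>
    by_cases hr : s = r'
    · subst hr
      simp only [Function.update_self, ServerState.repair.injEq] at hy
      obtain ⟨rfl, rfl⟩ := hy
      refine .inl ⟨got', hst, fun s t h => ?_⟩
      rcases eq_some_or_eq_of_update h with h | ⟨rfl, rfl⟩
      exacts [.inl h, .inr hmsg]
    · simp [hr] at hy
      exact .inl ⟨got, hy, fun s t h => .inl h⟩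
  all_goals try simp only [Function.update_apply] at hy
  all_goals grind

/-- An outbox shrinks unless the step starts a group-send of its process. -/
theorem Step.outbox_change (h : Step P i x a y) (p : Proc n W R) :
    y.outbox p ⊆ x.outbox p ∨ ∃ m, y.outbox p = groupSend i p m ∧ y.net = x.net ∧
      (∀ p', p' ≠ p → y.outbox p' = x.outbox p') ∧
      (∀ g s, a ≠ .send g s ∧ a ≠ .consume g s) ∧
      ∀ s t c, m s = .codeElement t c →
        (∃ w o v got, a = .writePutData w o t ∧ x.writers w = .getTag o v got ∧ c = P.Φ v s) ∨
        (∃ r o got v, x.readers r = .getData o got ∧ Decodable P got t v ∧ c = P.Φ v s) := by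
  cases h
  case invokeWrite w v hidle =>
    by_cases hp : p = .writer w
    · subst hp
      exact .inr ⟨fun _ => .queryTag, by simp, rfl, fun p' h => by simp [h], by simp, by simp⟩
    · exact .inl (by simp [hp])
  case invokeRead w hidle =>
    by_cases hp : p = .reader w
    · subst hp
      exact .inr ⟨fun _ => .queryList, by simp, rfl, fun p' h => by simp [h], by simp, by simp⟩
    · exact .inl (by simp [hp])
  case initRepair w hidle =>
    by_cases hp : p = .server w
    · subst hp
      exact .inr ⟨fun _ => .repairList, by simp, rfl, fun p' h => by simp [h], by simp, by simp⟩
    · exact .inl (by simp [hp])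
  case writePutData w o v got tmax hst hquorum hmax =>
    by_cases hp : p = .writer w
    · subst hp
      refine .inr ⟨fun s => .codeElement (toLex ((ofLex tmax).1 + 1, w)) (P.Φ v s), by simp, rfl,
        fun p' h => by simp [h], by simp, ?_⟩
      intro s t c h
      cases h
      exact .inl ⟨w, o, v, got, rfl, hst, rfl⟩
    · exact .inl (by simp [hp])
  case readPutData r o got t v hst hquorum hdec hmax =>
    by_cases hp : p = .reader r
    · subst hp
      refine .inr ⟨fun s => .codeElement t (P.Φ v s), by simp, rfl,
        fun p' h => by simp [h], by simp, ?_⟩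
      intro s t c h
      cases h
      exact .inr ⟨r, o, got, v, hst, hdec, rfl⟩
    · exact .inl (by simp [hp])
  all_goals refine .inl fun msg hmsg => ?_
  all_goals try simp only [Function.update_apply] at hmsg
  all_goals grind

theorem Step.net_change (h : Step P i x a y) :
    (y.net ⊆ x.net ∧ (∀ g s, a ≠ .send g s ∧ a ≠ .consume g s)) ∨
    (∃ p g s m, a = .send g s ∧ Message.req g p s m ∈ x.outbox p ∧
      Message.req g p s m ∉ y.outbox p ∧ (∀ p, y.outbox p ⊆ x.outbox p) ∧
      y.net = x.net ∪ {Message.req g p s m}) ∨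
    (∃ p g s m L L' b, a = .consume g s ∧ Message.req g p s m ∈ x.net ∧ y.outbox = x.outbox ∧
      x.servers s = .active L ∧ y.servers s = .active L' ∧ Serve P s L m L' b ∧
      y.net = (x.net \ {Message.req g p s m}) ∪ {Message.resp g s p b}) := by
  cases h
  case send p g s m hmsg =>
    refine .inr (.inl ⟨p, g, s, m, rfl, hmsg, by simp, fun p' => ?_, rfl⟩)
    by_cases hp : p' = p
    · subst hp
      simp
    · simp [hp]
  case consume p g s m L L' b hmsg hst hserve =>
    exact .inr (.inr ⟨p, g, s, m, L, L', b, rfl, hmsg, rfl, hst, by simp, hserve, rfl⟩)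
  all_goals exact .inl ⟨by simp, by simp⟩

end Step

namespace Execution

/-! ### Messages in an execution -/

variable (e : Execution P R)

/-- Step `g` starts the group-send of the messages `m` by the process `p`. -/
def Starts (g : ℕ) (p : Proc n W R) (m : Fin n → Request W C) : Prop :=
  (e.state (g + 1)).outbox p = groupSend g p m

theorem req_origin (i : ℕ) :
    (∀ p g p' s m, Message.req g p' s m ∈ (e.state i).outbox p →
      p' = p ∧ g < i ∧ ∃ M, e.Starts g p M ∧ M s = m) ∧
    ∀ g p s m, Message.req g p s m ∈ (e.state i).net →
      g < i ∧ ∃ M, e.Starts g p M ∧ M s = m := by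
  induction i with
  | zero => simp [e.init, initial]
  | succ i ih =>
    refine ⟨fun p g p' s m h => ?_, fun g p s m h => ?_⟩
    · rcases (e.step i).outbox_change p with hsub | ⟨M, hM, -⟩
      · obtain ⟨h1, h2, h3⟩ := ih.1 p g p' s m (hsub h)
        exact ⟨h1, by omega, h3⟩
      · rw [hM] at h
        obtain ⟨s', hs'⟩ := h
        simp only [Message.req.injEq] at hs'
        obtain ⟨rfl, rfl, rfl, rfl⟩ := hs'
        exact ⟨rfl, by omega, M, hM, rfl⟩
    · suffices Message.req g p s m ∈ (e.state i).net ∨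
          Message.req g p s m ∈ (e.state i).outbox p by
        rcases this with h | h
        · obtain ⟨h2, h3⟩ := ih.2 g p s m h
          exact ⟨by omega, h3⟩
        · obtain ⟨-, h2, h3⟩ := ih.1 p g p s m h
          exact ⟨by omega, h3⟩
      rcases (e.step i).net_change with ⟨hsub, -⟩ | ⟨p', g', s', m', -, hmem, -, -, hnet⟩ |
        ⟨p', g', s', m', L, L', b, -, hmem, -, -, -, -, hnet⟩
      · exact .inl (hsub h)
      · rw [hnet] at h
        rcases h with h | h
        · exact .inl h
        · simp only [Set.mem_singleton_iff, Message.req.injEq] at h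
          obtain ⟨rfl, rfl, rfl, rfl⟩ := h
          exact .inr hmem
      · rw [hnet] at h
        rcases h with h | h
        · exact .inl h.1
        · simp at h

theorem lt_of_req_mem_net {i g : ℕ} {p : Proc n W R} {s : Fin n} {m : Request W C}
    (h : Message.req g p s m ∈ (e.state i).net) : g < i :=
  ((e.req_origin i).2 g p s m h).1

theorem Starts.unique {e : Execution P R} {g : ℕ} {p p' : Proc n W R}
    {M M' : Fin n → Request W C} (h : e.Starts g p M) (h' : e.Starts g p' M') (s : Fin n) :
    p' = p ∧ M' s = M s := by
  -- No message with identifier `g` exists before step `g`, so the outbox of the starting process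
  -- must grow at this step; a step lets at most one outbox grow.
  have key : ∀ q N, e.Starts g q N → ¬ (e.state (g + 1)).outbox q ⊆ (e.state g).outbox q := by
    intro q N hq hsub
    have hmem : Message.req g q s (N s) ∈ (e.state (g + 1)).outbox q := by
      rw [hq]
      exact ⟨s, rfl⟩
    have := ((e.req_origin g).1 q g q s (N s) (hsub hmem)).2.1
    omega
  have hp : p' = p := by
    rcases (e.step g).outbox_change p with hsub | ⟨m, -, -, hne, -⟩
    · exact absurd hsub (key p M h)
    · by_contra hp
      exact key p' M' h' (hne p' hp).subset
  subst hp
  refine ⟨rfl, ?_⟩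
  have hmem : Message.req g p' s (M' s) ∈ groupSend g p' M := by
    rw [← h, h']
    exact ⟨s, rfl⟩
  obtain ⟨s', hs'⟩ := hmem
  simp only [Message.req.injEq] at hs'
  obtain ⟨-, -, rfl, h4⟩ := hs'
  exact h4.symm

theorem req_unique_net {i g : ℕ} {p p' : Proc n W R} {s : Fin n} {m m' : Request W C}
    (h : Message.req g p s m ∈ (e.state i).net)
    (h' : Message.req g p' s m' ∈ (e.state i).net) : p' = p ∧ m' = m := by
  obtain ⟨-, M, hM, rfl⟩ := (e.req_origin i).2 g p s m h
  obtain ⟨-, M', hM', rfl⟩ := (e.req_origin i).2 g p' s m' h'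
  exact hM.unique hM' s

theorem req_unique_outbox {i g : ℕ} {p p' q q' : Proc n W R} {s : Fin n} {m m' : Request W C}
    (h : Message.req g p s m ∈ (e.state i).outbox q)
    (h' : Message.req g p' s m' ∈ (e.state i).outbox q') : p' = p ∧ q' = q ∧ m' = m := by
  obtain ⟨rfl, -, M, hM, rfl⟩ := (e.req_origin i).1 q g p s m h
  obtain ⟨rfl, -, M', hM', rfl⟩ := (e.req_origin i).1 q' g p' s m' h'
  have := hM.unique hM' s
  exact ⟨this.1, this.1, this.2⟩

theorem consume_inv {j g : ℕ} {s : Fin n} (h : e.act j = .consume g s) :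
    ∃ p m L L' b, Message.req g p s m ∈ (e.state j).net ∧
      (e.state j).servers s = .active L ∧ (e.state (j + 1)).servers s = .active L' ∧
      Serve P s L m L' b := by
  rcases (e.step j).net_change with ⟨-, hne⟩ | ⟨p', g', s', m', ha, -⟩ |
    ⟨p', g', s', m', L, L', b, ha, hmem, -, h1, h2, h3, -⟩
  · exact absurd h (hne g s).2
  · rw [h] at ha
    cases ha
  · rw [h] at ha
    cases ha
    exact ⟨p', m', L, L', b, hmem, h1, h2, h3⟩

theorem lt_of_consume {j g : ℕ} {s : Fin n} (h : e.act j = .consume g s) : g < j := by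
  obtain ⟨p, m, L, L', b, hmem, -⟩ := e.consume_inv h
  exact e.lt_of_req_mem_net hmem

/-- A message is in at most one place, and is never seen again after its consumption. -/
theorem not_consumed (i g : ℕ) (s : Fin n) :
    (∀ q p m, Message.req g p s m ∈ (e.state i).outbox q →
      (∀ p' m', Message.req g p' s m' ∉ (e.state i).net) ∧ ∀ j < i, e.act j ≠ .consume g s) ∧
    ∀ p m, Message.req g p s m ∈ (e.state i).net → ∀ j < i, e.act j ≠ .consume g s := by
  induction i with
  | zero => simp [e.init, initial]
  | succ i ih =>
    have hlt : ∀ j < i + 1, (j < i ∨ j = i) := fun j hj => by omega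
    rcases (e.step i).net_change with ⟨hsub, hne⟩ | ⟨p', g', s', m', ha, hmem, hnot, hout, hnet⟩ |
        ⟨p', g', s', m', L, L', b, ha, hmem, hout, -, -, -, hnet⟩
    · refine ⟨fun q p m h => ?_, fun p m h j hj => ?_⟩
      · rcases (e.step i).outbox_change q with hsub' | ⟨M, hM, hnet, -⟩
        · refine ⟨fun p' m' h' => (ih.1 q p m (hsub' h)).1 p' m' (hsub h'), fun j hj => ?_⟩
          rcases hlt j hj with hj | rfl
          · exact (ih.1 q p m (hsub' h)).2 j hj
          · exact (hne g s).2
        · rw [hM] at h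
          obtain ⟨s', hs'⟩ := h
          simp only [Message.req.injEq] at hs'
          obtain ⟨rfl, rfl, rfl, rfl⟩ := hs'
          refine ⟨fun p' m' h' => ?_, fun j hj hc => ?_⟩
          · have := e.lt_of_req_mem_net (hsub h')
            omega
          · have := e.lt_of_consume hc
            omega
      · rcases hlt j hj with hj | rfl
        · exact ih.2 p m (hsub h) j hj
        · exact (hne g s).2
    · have hi : e.act i ≠ .consume g s := by simp [ha]
      refine ⟨fun q p m h => ⟨fun p₁ m₁ h₁ => ?_, fun j hj => ?_⟩, fun p m h j hj => ?_⟩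
      · rw [hnet] at h₁
        rcases h₁ with h₁ | h₁
        · exact (ih.1 q p m (hout q h)).1 p₁ m₁ h₁
        · simp only [Set.mem_singleton_iff, Message.req.injEq] at h₁
          obtain ⟨rfl, rfl, rfl, rfl⟩ := h₁
          obtain ⟨rfl, rfl, rfl⟩ := e.req_unique_outbox hmem (hout q h)
          exact hnot h
      · rcases hlt j hj with hj | rfl
        · exact (ih.1 q p m (hout q h)).2 j hj
        · exact hi
      · rcases hlt j hj with hj | rfl
        · rw [hnet] at h
          rcases h with h | h
          · exact ih.2 p m h j hj
          · simp only [Set.mem_singleton_iff, Message.req.injEq] at h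
            obtain ⟨rfl, rfl, rfl, rfl⟩ := h
            exact (ih.1 p p m hmem).2 j hj
        · exact hi
    · rw [hnet, hout]
      refine ⟨fun q p m h => ⟨fun p₁ m₁ h₁ => ?_, fun j hj => ?_⟩, fun p m h j hj => ?_⟩
      · rcases h₁ with h₁ | h₁
        · exact (ih.1 q p m h).1 p₁ m₁ h₁.1
        · simp at h₁
      · rcases hlt j hj with hj | rfl
        · exact (ih.1 q p m h).2 j hj
        · rw [ha]
          rintro ⟨rfl, rfl⟩
          exact (ih.1 q p m h).1 p' m' hmem
      · rcases h with h | h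
        · rcases hlt j hj with hj | rfl
          · exact ih.2 p m h.1 j hj
          · rw [ha]
            rintro ⟨rfl, rfl⟩
            obtain ⟨rfl, rfl⟩ := e.req_unique_net hmem h.1
            exact h.2 rfl
        · simp at h

/-- This identifies the consumption promised by N1 with the one that produced a received ack. -/
theorem consume_unique {i j g : ℕ} {s : Fin n} (hi : e.act i = .consume g s)
    (hj : e.act j = .consume g s) : i = j := by
  have key : ∀ i j, e.act i = .consume g s → e.act j = .consume g s → ¬ j < i := by
    intro i j hi hj hlt
    obtain ⟨p, m, L, L', b, hmem, -⟩ := e.consume_inv hi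
    exact (e.not_consumed i g s).2 p m hmem j hlt hj
  have h1 := key i j hi hj
  have h2 := key j i hj hi
  omega

theorem resp_origin {i g : ℕ} {s : Fin n} {p : Proc n W R} {b : Response W C}
    (h : Message.resp g s p b ∈ (e.state i).net) :
    ∃ j m L L', j < i ∧ g < j ∧ e.act j = .consume g s ∧ (e.state j).servers s = .active L ∧
      Serve P s L m L' b := by
  induction i with
  | zero => simp [e.init, initial] at h
  | succ i ih =>
    have lift (h' : Message.resp g s p b ∈ (e.state i).net) : ∃ j m L L', j < i + 1 ∧ g < j ∧
        e.act j = .consume g s ∧ (e.state j).servers s = .active L ∧ Serve P s L m L' b := by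
      obtain ⟨j, m, L, L', hj, h2⟩ := ih h'
      exact ⟨j, m, L, L', Nat.lt_succ_of_lt hj, h2⟩
    rcases (e.step i).net_change with ⟨hsub, -⟩ | ⟨p', g', s', m', -, hmem, -, -, hnet⟩ |
        ⟨p', g', s', m', L, L', b', ha, hmem, -, hL, -, hserve, hnet⟩
    · exact lift (hsub h)
    · rw [hnet] at h
      rcases h with h | h
      · exact lift h
      · simp at h
    · rw [hnet] at h
      rcases h with h | h
      · exact lift h.1
      · simp only [Set.mem_singleton_iff, Message.resp.injEq] at h
        obtain ⟨rfl, rfl, rfl, rfl⟩ := h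
        exact ⟨i, m', L, L', by omega, e.lt_of_consume ha, ha, hL, hserve⟩

/-- The bound `g < j` is the point: a list shows the server after the query began, hence after
anything established before the operation started. -/
theorem resp_list_origin {i g : ℕ} {s : Fin n} {p : Proc n W R} {L : CodedList W C}
    (h : Message.resp g s p (.list L) ∈ (e.state i).net) :
    ∃ j, g < j ∧ j < i ∧ (e.state j).servers s = .active L := by
  obtain ⟨j, m, L₁, L', hj, hg, -, hL, hserve⟩ := e.resp_origin h
  cases hserve <;> exact ⟨j, hg, hj, hL⟩

theorem resp_tag_origin {i g : ℕ} {s : Fin n} {p : Proc n W R} {t : Tag W}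
    (h : Message.resp g s p (.tag t) ∈ (e.state i).net) :
    ∃ j L, g < j ∧ j < i ∧ (e.state j).servers s = .active L ∧ MaxTag P.t₀ L t := by
  obtain ⟨j, m, L₁, L', hj, hg, -, hL, hserve⟩ := e.resp_origin h
  cases hserve
  case getTagResp hmax => exact ⟨j, L₁, hg, hj, hL, hmax⟩

/-! ### Local states of the processes -/

theorem getTag_origin {i o : ℕ} {w : W} {v : V} {got : Fin n → Option (Tag W)}
    (h : (e.state i).writers w = .getTag o v got) :
    o < i ∧ e.act o = .invokeWrite w v ∧ ∀ s t, got s = some t →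
      ∃ j L, o < j ∧ j < i ∧ (e.state j).servers s = .active L ∧ MaxTag P.t₀ L t := by
  induction i generalizing got with
  | zero => simp [e.init, initial] at h
  | succ i ih =>
    rcases (e.step i).writer_getTag h with ⟨got', h', hgot⟩ | ⟨rfl, ha, rfl⟩
    · obtain ⟨h1, h2, h3⟩ := ih h'
      refine ⟨by omega, h2, fun s t hs => ?_⟩
      suffices ∃ j L, o < j ∧ j < i ∧ (e.state j).servers s = .active L ∧ MaxTag P.t₀ L t by
        obtain ⟨j, L, hj, hi, h4⟩ := this
        exact ⟨j, L, hj, by omega, h4⟩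
      rcases hgot s t hs with h4 | h4
      · exact h3 s t h4
      · exact e.resp_tag_origin h4
    · exact ⟨by omega, ha, by simp⟩

theorem getData_origin {i o : ℕ} {r : R} {got : Fin n → Option (CodedList W C)}
    (h : (e.state i).readers r = .getData o got) :
    o < i ∧ e.act o = .invokeRead r ∧ ∀ s L, got s = some L →
      ∃ j, o < j ∧ j < i ∧ (e.state j).servers s = .active L := by
  induction i generalizing got with
  | zero => simp [e.init, initial] at h
  | succ i ih =>
    rcases (e.step i).reader_getData h with ⟨got', h', -, hgot⟩ | ⟨rfl, ha, rfl⟩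
    · obtain ⟨h1, h2, h3⟩ := ih h'
      refine ⟨by omega, h2, fun s L hs => ?_⟩
      suffices ∃ j, o < j ∧ j < i ∧ (e.state j).servers s = .active L by
        obtain ⟨j, hj, hi, h4⟩ := this
        exact ⟨j, hj, by omega, h4⟩
      rcases hgot s L hs with h4 | h4
      · exact h3 s L h4
      · exact e.resp_list_origin h4
    · exact ⟨by omega, ha, by simp⟩

/-- The clause on inactivity is what later excludes that a repair overlaps a period in which its
server is known to be active. -/
theorem repair_origin {i o : ℕ} {s : Fin n} {got : Fin n → Option (CodedList W C)}
    (h : (e.state i).servers s = .repair o got) :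
    o < i ∧ e.act o = .initRepair s ∧ (∀ j, o < j → j ≤ i → ¬ e.Active s j) ∧
      ∀ s' L, got s' = some L →
        ∃ j, o < j ∧ j < i ∧ (e.state j).servers s' = .active L := by
  induction i generalizing got with
  | zero => simp [e.init, initial] at h
  | succ i ih =>
    have hna : ¬ e.Active s (i + 1) := by
      rintro ⟨L, hL⟩
      rw [hL] at h
      cases h
    rcases (e.step i).server_repair h with ⟨got', h', hgot⟩ | ⟨rfl, ha, rfl⟩
    · obtain ⟨h1, h2, h3, h4⟩ := ih h'
      refine ⟨by omega, h2, fun j hj hji => ?_, fun s L hs => ?_⟩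
      · rcases Nat.le_succ_iff.1 hji with hji | rfl
        · exact h3 j hj hji
        · exact hna
      suffices ∃ j, o < j ∧ j < i ∧ (e.state j).servers s = .active L by
        obtain ⟨j, hj, hi, h4⟩ := this
        exact ⟨j, hj, by omega, h4⟩
      rcases hgot s L hs with h5 | h5
      · exact h4 s L h5
      · exact e.resp_list_origin h5
    · refine ⟨by omega, ha, fun j hj hji => ?_, by simp⟩
      obtain rfl : j = o + 1 := by omega
      exact hna

/-- The facts about a group-send `g` that writes `(t, v)`, at time `i`, when the servers in `acks`
are known to have acknowledged it. -/
structure PutDataAt (p : Proc n W R) (g i : ℕ) (t : Tag W) (v : V) (acks : Finset (Fin n)) :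
    Prop where
  starts : e.Starts g p fun s => .codeElement t (P.Φ v s)
  consumed : ∀ s ∈ acks, ∃ j < i, e.act j = .consume g s
  sent : ∀ s, Message.req g p s (.codeElement t (P.Φ v s)) ∈ (e.state i).outbox p ∨
    ∃ j, e.act j = .send g s
  all_sent : acks.Nonempty → ∀ s, ∃ j, e.act j = .send g s

variable {e}

theorem PutDataAt.start {p : Proc n W R} {g : ℕ} {t : Tag W} {v : V}
    (h : e.Starts g p fun s => .codeElement t (P.Φ v s)) : e.PutDataAt p g (g + 1) t v ∅ where
  starts := h
  consumed := by simp
  sent s := .inl (by rw [h]; exact ⟨s, rfl⟩)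
  all_sent := by simp

theorem PutDataAt.succ {p : Proc n W R} {g i : ℕ} {t : Tag W} {v : V}
    {acks acks' : Finset (Fin n)} (h : e.PutDataAt p g i t v acks')
    (hacks : ∀ s ∈ acks, s ∈ acks' ∨
      ((e.state i).outbox p = ∅ ∧ Message.resp g s p .ack ∈ (e.state i).net))
    (hout : ∀ g' s m, Message.req g' p s m ∈ (e.state i).outbox p →
      Message.req g' p s m ∈ (e.state (i + 1)).outbox p ∨ e.act i = .send g' s) :
    e.PutDataAt p g (i + 1) t v acks where
  starts := h.starts
  consumed s hs := by
    rcases hacks s hs with hs | ⟨-, hs⟩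
    · obtain ⟨j, hj, hc⟩ := h.consumed s hs
      exact ⟨j, by omega, hc⟩
    · obtain ⟨j, m, L, L', hj, -, hc, -⟩ := e.resp_origin hs
      exact ⟨j, by omega, hc⟩
  sent s := by
    rcases h.sent s with hs | hs
    · rcases hout _ _ _ hs with h1 | h1
      · exact .inl h1
      · exact .inr ⟨i, h1⟩
    · exact .inr hs
  all_sent := by
    rintro ⟨s₀, hs₀⟩ s
    -- Either an earlier ack is already known, or this is a new one, accepted with an empty outbox;
    -- then nothing is left to be sent.
    rcases hacks s₀ hs₀ with hs | ⟨hemp, -⟩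
    · exact h.all_sent ⟨s₀, hs⟩ s
    · simpa [hemp] using h.sent s

variable (e)

theorem writer_putData_origin {i o g : ℕ} {w : W} {acks : Finset (Fin n)}
    (h : (e.state i).writers w = .putData o g acks) :
    ∃ t v, o < g ∧ g < i ∧ e.act o = .invokeWrite w v ∧ e.act g = .writePutData w o t ∧
      e.PutDataAt (.writer w) g i t v acks := by
  induction i generalizing acks with
  | zero => simp [e.init, initial] at h
  | succ i ih =>
    rcases (e.step i).writer_putData h with ⟨acks', h', hacks, hout⟩ |
      ⟨rfl, rfl, t, v, got, ha, hst, hstart⟩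
    · obtain ⟨t, v, h1, h2, h3, h4, h5⟩ := ih h'
      exact ⟨t, v, h1, by omega, h3, h4, h5.succ hacks hout⟩
    · obtain ⟨h1, h2, -⟩ := e.getTag_origin hst
      exact ⟨t, v, h1, by omega, h2, ha, .start hstart⟩

theorem reader_putData_origin {i o g : ℕ} {r : R} {v : V} {acks : Finset (Fin n)}
    (h : (e.state i).readers r = .putData o g v acks) :
    ∃ t got, o < g ∧ g < i ∧ e.act o = .invokeRead r ∧ e.act g = .readPutData r o t ∧
      (e.state g).readers r = .getData o got ∧ Decodable P got t v ∧
      e.PutDataAt (.reader r) g i t v acks := by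
  induction i generalizing acks with
  | zero => simp [e.init, initial] at h
  | succ i ih =>
    rcases (e.step i).reader_putData h with ⟨acks', h', hacks, hout⟩ |
      ⟨rfl, rfl, t, got, ha, hst, hdec, hstart⟩
    · obtain ⟨t, got, h1, h2, h3, h4, h5, h6, h7⟩ := ih h'
      exact ⟨t, got, h1, by omega, h3, h4, h5, h6, h7.succ hacks hout⟩
    · obtain ⟨h1, h2, -⟩ := e.getData_origin hst
      exact ⟨t, got, h1, by omega, h2, ha, hst, hdec, .start hstart⟩

/-! ### Inversion of actions -/

theorem writePutData_inv {j o : ℕ} {w : W} {t : Tag W} (h : e.act j = .writePutData w o t) :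
    ∃ v got tmax, (e.state j).writers w = .getTag o v got ∧ (heard got).card = majority n ∧
      IsGreatest {t | ∃ s, got s = some t} tmax ∧ t = toLex ((ofLex tmax).1 + 1, w) ∧
      ∃ acks, (e.state (j + 1)).writers w = .putData o j acks := by
  have hs := e.step j
  rw [h] at hs
  generalize e.state (j + 1) = y at hs
  cases hs
  case writePutData v got tmax h1 h2 h3 => exact ⟨v, got, tmax, h3, h1, h2, rfl, ∅, by simp⟩

theorem readPutData_inv {j o : ℕ} {r : R} {t : Tag W} (h : e.act j = .readPutData r o t) :
    ∃ got, (e.state j).readers r = .getData o got ∧ (heard got).card = listQuorum n P.k ∧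
      (∃ v, Decodable P got t v) ∧ (∀ t' v', Decodable P got t' v' → t' ≤ t) ∧
      ∃ v acks, (e.state (j + 1)).readers r = .putData o j v acks := by
  have hs := e.step j
  rw [h] at hs
  generalize e.state (j + 1) = y at hs
  cases hs
  case readPutData got v h1 h2 h3 h4 => exact ⟨got, h2, h1, ⟨v, h3⟩, h4, v, ∅, by simp⟩

theorem respondWrite_inv {j o : ℕ} {w : W} (h : e.act j = .respondWrite w o) :
    ∃ g acks, (e.state j).writers w = .putData o g acks ∧ acks.card = ackQuorum n P.k := by
  have hs := e.step j
  rw [h] at hs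
  generalize e.state (j + 1) = y at hs
  cases hs
  case respondWrite g acks h1 h2 => exact ⟨g, acks, h2, h1⟩

theorem respondRead_inv {j o : ℕ} {r : R} {v : V} (h : e.act j = .respondRead r o v) :
    ∃ g acks, (e.state j).readers r = .putData o g v acks ∧ acks.card = ackQuorum n P.k := by
  have hs := e.step j
  rw [h] at hs
  generalize e.state (j + 1) = y at hs
  cases hs
  case respondRead g acks h1 h2 => exact ⟨g, acks, h2, h1⟩

theorem invokeWrite_inv {j : ℕ} {w : W} {v : V} (h : e.act j = .invokeWrite w v) :
    (e.state j).writers w = .idle ∧ ∃ got, (e.state (j + 1)).writers w = .getTag j v got := by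
  have hs := e.step j
  rw [h] at hs
  generalize e.state (j + 1) = y at hs
  cases hs
  case invokeWrite h1 => exact ⟨h1, fun _ => none, by simp⟩

end Execution

/-! ### Quorums and pruning -/

theorem add_le_two_mul_listQuorum (n k : ℕ) : n + k ≤ 2 * listQuorum n k := by
  have h := Nat.le_ceil (((n : ℚ) + k) / 2)
  rw [div_le_iff₀ (by norm_num)] at h
  have : (n : ℚ) + k ≤ 2 * (listQuorum n k : ℚ) := by
    unfold listQuorum
    linarith
  exact_mod_cast this

theorem add_le_four_mul_ackQuorum (n k : ℕ) : 3 * n + k ≤ 4 * ackQuorum n k := by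
  have h := Nat.le_ceil ((3 * (n : ℚ) + k) / 4)
  rw [div_le_iff₀ (by norm_num)] at h
  have : 3 * (n : ℚ) + k ≤ 4 * (ackQuorum n k : ℚ) := by
    unfold ackQuorum
    linarith
  exact_mod_cast this

theorem card_add_card_le (A B : Finset (Fin n)) : A.card + B.card ≤ n + (A ∩ B).card := by
  have h1 := Finset.card_union_add_card_inter A B
  have h2 := Finset.card_le_univ (A ∪ B)
  simp only [Fintype.card_fin] at h2
  omega

theorem mem_heard {α : Type*} {got : Fin n → Option α} {s : Fin n} :
    s ∈ heard got ↔ ∃ a, got s = some a := by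
  simp [heard, Option.isSome_iff_exists]

/-- Quorum intersection: two sets of at least (n+k)/2 servers out of n have at least k in common. -/
theorem decodable_of_forall_mem {W V C : Type*} {P : Params n W V C}
    {got : Fin n → Option (CodedList W C)} {G : Finset (Fin n)}
    {t : Tag W} {v : V} (hG : n + P.k ≤ 2 * G.card) (hgot : (heard got).card = listQuorum n P.k)
    (hmem : ∀ s ∈ G, ∀ L, got s = some L → (t, P.Φ v s) ∈ L) : Decodable P got t v := by
  have h1 := add_le_two_mul_listQuorum n P.k
  have h2 := card_add_card_le (heard got) G
  obtain ⟨S, hS, hcard⟩ := Finset.exists_subset_card_eq (s := heard got ∩ G) (n := P.k) (by omega)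
  refine ⟨S, hcard, fun s hs => ?_⟩
  obtain ⟨h3, h4⟩ := Finset.mem_inter.1 (hS hs)
  obtain ⟨L, hL⟩ := mem_heard.1 h3
  exact ⟨L, hL, hmem s h4 L hL⟩

/-- The set `X` stands for the tags in use up to a later time, so that one bound serves for all
lists up to then. -/
theorem mem_prune {δ : ℕ} {L : CodedList W C} {p : Tag W × C} {X : Set (Tag W)} (hp : p ∈ L)
    (hX : Prod.fst '' L ⊆ X) (hδ : (X ∩ Set.Ioi p.1).encard ≤ δ) : p ∈ prune δ L :=
  ⟨hp, (Set.encard_le_encard (Set.inter_subset_inter_left (Set.Ioi p.1) hX)).trans hδ⟩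

/-- The greatest tag of a finite list has no tag above it and therefore survives pruning for every
`δ`, including 0. -/
theorem exists_ge_mem_prune {δ : ℕ} {L : CodedList W C} (hfin : (Prod.fst '' L).Finite)
    {p : Tag W × C} (hp : p ∈ L) : ∃ q ∈ prune δ L, p.1 ≤ q.1 := by
  obtain ⟨t, ⟨⟨q, hq, rfl⟩, hmax⟩⟩ :=
    hfin.exists_maximal (s := Prod.fst '' L) ⟨p.1, p, hp, rfl⟩
  have hmax' : ∀ t ∈ Prod.fst '' L, t ≤ q.1 := fun t ht => by
    rcases le_total t q.1 with h | h
    exacts [h, hmax ht h]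
  refine ⟨q, ⟨hq, ?_⟩, hmax' _ ⟨p, hp, rfl⟩⟩
  rw [Set.encard_eq_zero.2]
  · exact zero_le
  · exact Set.eq_empty_of_forall_notMem fun t ht => (hmax' t ht.1).not_gt ht.2

theorem prune_subset {δ : ℕ} {L : CodedList W C} : prune δ L ⊆ L := fun _ h => h.1

/-- Fixing `o` makes this an invariant of one operation: it can be left only by the response of `o`.
Crashes are permanent and so stay inside it. -/
theorem Step.writer_busy {i : ℕ} {x y : State n W R V C} {a : Action n W R V}
    (h : Step P i x a y) {w : W} {o : ℕ}
    (hx : (∃ v got, x.writers w = .getTag o v got) ∨ (∃ g acks, x.writers w = .putData o g acks) ∨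
      x.writers w = .crashed) :
    (∃ v got, y.writers w = .getTag o v got) ∨ (∃ g acks, y.writers w = .putData o g acks) ∨
      y.writers w = .crashed ∨ a = .respondWrite w o := by
  cases h
  all_goals try simp only [Function.update_apply]
  all_goals grind

namespace Execution

/-! ### Provenance of tags and coded elements -/

section Provenance

variable (e : Execution P R)

/-- A property of (tag, coded-element) pairs that holds initially, holds for the pairs sent by
writers and is preserved by decoding holds for all pairs in the lists and in the messages. -/
theorem forall_pairs (Good : ℕ → Fin n → Tag W → C → Prop)
    (hmono : ∀ i j s t c, i ≤ j → Good i s t c → Good j s t c)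
    (hinit : ∀ s, Good 0 s P.t₀ (P.Φ P.v₀ s))
    (hwrite : ∀ j w o t v, e.act j = .writePutData w o t → e.act o = .invokeWrite w v →
      ∀ s, Good (j + 1) s t (P.Φ v s))
    (hdec : ∀ i t v (S : Finset (Fin n)), S.card = P.k → (∀ s ∈ S, Good i s t (P.Φ v s)) →
      ∀ s, Good i s t (P.Φ v s)) (i : ℕ) :
    (∀ s L, (e.state i).servers s = .active L → ∀ p ∈ L, Good i s p.1 p.2) ∧
    (∀ q g p s t c, Message.req g p s (.codeElement t c) ∈ (e.state i).outbox q → Good i s t c) ∧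
    ∀ g p s t c, Message.req g p s (.codeElement t c) ∈ (e.state i).net → Good i s t c := by
  -- Decoding at step `i` draws on lists as they were at various earlier times, hence the strong
  -- induction.
  induction i using Nat.strong_induction_on with
  | _ i ih =>
  cases i with
  | zero =>
    refine ⟨fun s L hL p hp => ?_, ?_, ?_⟩
    · simp only [e.init, initial, ServerState.active.injEq] at hL
      subst hL
      obtain rfl := hp
      exact hinit s
    · simp [e.init, initial]
    · simp [e.init, initial]
  | succ i =>
    have hi := ih i (by omega)
    have up : ∀ s t c, Good i s t c → Good (i + 1) s t c := fun s t c =>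
      hmono i (i + 1) s t c (by omega)
    have hdecode : ∀ got t v, Decodable P got t v →
        (∀ s L, got s = some L → ∃ j, j < i ∧ (e.state j).servers s = .active L) →
        ∀ s, Good (i + 1) s t (P.Φ v s) := by
      rintro got t v ⟨S, hS, hmem⟩ hgot
      refine hdec _ t v S hS fun s hs => ?_
      obtain ⟨L, hL, hp⟩ := hmem s hs
      obtain ⟨j, hj, hact⟩ := hgot s L hL
      exact hmono j _ _ _ _ (by omega) ((ih j (by omega)).1 s L hact _ hp)
    have hout : ∀ q g p s t c,
        Message.req g p s (.codeElement t c) ∈ (e.state (i + 1)).outbox q →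
        Good (i + 1) s t c := by
      intro q g p s t c h
      rcases (e.step i).outbox_change q with hsub | ⟨m, hm, -, -, -, hsrc⟩
      · exact up _ _ _ (hi.2.1 q g p s t c (hsub h))
      · rw [hm] at h
        obtain ⟨s', hs'⟩ := h
        simp only [Message.req.injEq] at hs'
        obtain ⟨-, -, rfl, h4⟩ := hs'
        rcases hsrc s' t c h4 with ⟨w, o, v, got, ha, hst, rfl⟩ | ⟨r, o, got, v, hst, hd, rfl⟩
        · exact hwrite i w o t v ha (e.getTag_origin hst).2.1 s'
        · refine hdecode got t v hd (fun s L hL => ?_) s'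
          obtain ⟨j, -, h5, h6⟩ := (e.getData_origin hst).2.2 s L hL
          exact ⟨j, h5, h6⟩
    refine ⟨fun s L hL p hp => ?_, hout, fun g p s t c h => ?_⟩
    · rcases (e.step i).server_active hL with ⟨L₀, hL₀, rfl | ⟨p', g, t, c, hmem, rfl⟩⟩ |
        ⟨o, got, -, hst, -, rfl⟩
      · exact up _ _ _ (hi.1 s L hL₀ p hp)
      · rcases prune_subset hp with hp | rfl
        · exact up _ _ _ (hi.1 s L₀ hL₀ p hp)
        · exact up _ _ _ (hi.2.2 g p' s t c hmem)
      · obtain ⟨v, hd, h2⟩ := prune_subset hp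
        rw [h2]
        refine hdecode got _ v hd (fun s L hL => ?_) s
        obtain ⟨j, -, h5, h6⟩ := (e.repair_origin hst).2.2.2 s L hL
        exact ⟨j, h5, h6⟩
    · rcases (e.step i).net_change with ⟨hsub, -⟩ | ⟨p', g', s', m', -, hmem, -, -, hnet⟩ |
        ⟨p', g', s', m', L, L', b, -, hmem, -, -, -, -, hnet⟩
      · exact up _ _ _ (hi.2.2 g p s t c (hsub h))
      · rw [hnet] at h
        rcases h with h | h
        · exact up _ _ _ (hi.2.2 g p s t c h)
        · cases Set.mem_singleton_iff.1 h
          exact up _ _ _ (hi.2.1 p g p s t c hmem)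
      · rw [hnet] at h
        rcases h with h | h
        · exact up _ _ _ (hi.2.2 g p s t c h.1)
        · simp at h

/-- The tags in use before step `i`. -/
def tagsBefore (i : ℕ) : Set (Tag W) :=
  {t | t = P.t₀ ∨ ∃ j < i, ∃ w o, e.act j = .writePutData w o t}

theorem tagsBefore_mono {i j : ℕ} (h : i ≤ j) : e.tagsBefore i ⊆ e.tagsBefore j := by
  rintro t (ht | ⟨l, hl, ht⟩)
  exacts [.inl ht, .inr ⟨l, by omega, ht⟩]

theorem finite_tagsBefore (i : ℕ) : (e.tagsBefore i).Finite := by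
  let f : Action n W R V → Tag W := fun
    | .writePutData _ _ t => t
    | _ => P.t₀
  refine ((Set.finite_singleton P.t₀).union ((Set.finite_Iio i).image fun j => f (e.act j))).subset ?_
  rintro t (ht | ⟨l, hl, w, o, ht⟩)
  · exact .inl ht
  · exact .inr ⟨l, hl, by simp [ht, f]⟩

/-- Positivity of k ensures that a decoded tag really occurs in one of the lists; for k = 0 every
tag would be vacuously decodable. -/
theorem tags_in_use (hk : 1 ≤ P.k) (i : ℕ) :
    (∀ s L, (e.state i).servers s = .active L → Prod.fst '' L ⊆ e.tagsBefore i) ∧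
    ∀ g p s t c, Message.req g p s (.codeElement t c) ∈ (e.state i).net → t ∈ e.tagsBefore i := by
  have h := e.forall_pairs (fun i _ t _ => t ∈ e.tagsBefore i)
    (fun i j s t c hij ht => e.tagsBefore_mono hij ht) (fun s => .inl rfl)
    (fun j w o t v hj _ s => .inr ⟨j, by omega, w, o, hj⟩)
    (fun i t v S hS hmem s => by
      obtain ⟨s', hs'⟩ := Finset.card_pos.1 (by omega : 0 < S.card)
      exact hmem s' hs') i
  refine ⟨?_, h.2.2⟩
  rintro s L hL t ⟨p, hp, rfl⟩
  exact h.1 s L hL p hp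

theorem decodable_tag_in_use (hk : 1 ≤ P.k) {got : Fin n → Option (CodedList W C)} {i : ℕ}
    (hgot : ∀ s L, got s = some L → ∃ j < i, (e.state j).servers s = .active L)
    {t : Tag W} {v : V} (h : Decodable P got t v) : t ∈ e.tagsBefore i := by
  obtain ⟨S, hS, hmem⟩ := h
  obtain ⟨s, hs⟩ := Finset.card_pos.1 (by omega : 0 < S.card)
  obtain ⟨L, hL, hp⟩ := hmem s hs
  obtain ⟨j, hj, hact⟩ := hgot s L hL
  exact e.tagsBefore_mono hj.le ((e.tags_in_use hk j).1 s L hact ⟨_, hp, rfl⟩)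

/-- The largest tag received is `P.t₀` or an earlier write tag, by strong induction at least `P.t₀`,
and the new tag has a strictly larger first component. The conventional answer of an empty list is
harmless here. -/
theorem t₀_lt_of_writePutData (hk : 1 ≤ P.k) {j o : ℕ} {w : W} {t : Tag W}
    (h : e.act j = .writePutData w o t) : P.t₀ < t := by
  induction j using Nat.strong_induction_on generalizing w o t with
  | _ j ih =>
  obtain ⟨v, got, tmax, hst, -, ⟨⟨s, hs⟩, -⟩, rfl, -⟩ := e.writePutData_inv h
  obtain ⟨i, L, -, hi, hact, hmax⟩ := (e.getTag_origin hst).2.2 s tmax hs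
  have hle : P.t₀ ≤ tmax := by
    rcases hmax with ⟨hmem, -⟩ | ⟨-, rfl⟩
    · rcases (e.tags_in_use hk i).1 s L hact hmem with rfl | ⟨l, hl, w', o', h'⟩
      · exact le_rfl
      · exact (ih l (by omega) h').le
    · exact le_rfl
  rw [Prod.Lex.le_iff] at hle
  rw [Prod.Lex.lt_iff]
  left
  simp only [ofLex_toLex]
  rcases hle with h1 | ⟨h1, -⟩ <;> omega

theorem t₀_le_of_mem_tagsBefore (hk : 1 ≤ P.k) {i : ℕ} {t : Tag W} (h : t ∈ e.tagsBefore i) :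
    P.t₀ ≤ t := by
  rcases h with rfl | ⟨j, -, w, o, h⟩
  exacts [le_rfl, (e.t₀_lt_of_writePutData hk h).le]

end Provenance

/-! ### Operations and their tags -/

section Operations

variable (e : Execution P R)

theorem writePutData_unique {j j' o : ℕ} {w w' : W} {t t' : Tag W}
    (h : e.act j = .writePutData w o t) (h' : e.act j' = .writePutData w' o t') : j = j' := by
  -- Once an operation has left get-tag it cannot return: entering that phase with identifier `o`
  -- happens only at step `o`, which has passed.
  have key : ∀ j w t, e.act j = .writePutData w o t →
      ∀ i, j < i → ∀ v got, (e.state i).writers w ≠ .getTag o v got := by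
    intro j w t h i hi
    obtain ⟨v₀, got₀, -, hst, -, -, -, acks, hnext⟩ := e.writePutData_inv h
    have ho := (e.getTag_origin hst).1
    induction i, hi using Nat.le_induction with
    | base => simp [hnext]
    | succ i hi ih =>
      intro v got hg
      rcases (e.step i).writer_getTag hg with ⟨got', hst', -⟩ | ⟨rfl, -⟩
      · exact ih v got' hst'
      · omega
  obtain ⟨v₁, got₁, -, hst₁, -⟩ := e.writePutData_inv h
  obtain ⟨v₂, got₂, -, hst₂, -⟩ := e.writePutData_inv h'
  have h1 := (e.getTag_origin hst₁).2.1
  have h2 := (e.getTag_origin hst₂).2.1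
  rw [h1] at h2
  cases h2
  rcases lt_trichotomy j j' with hlt | heq | hlt
  · exact absurd hst₂ (key j w t h j' hlt _ _)
  · exact heq
  · exact absurd hst₁ (key j' w t' h' j hlt _ _)

theorem readPutData_unique {j j' o : ℕ} {r r' : R} {t t' : Tag W}
    (h : e.act j = .readPutData r o t) (h' : e.act j' = .readPutData r' o t') : j = j' := by
  have key : ∀ j r t, e.act j = .readPutData r o t →
      ∀ i, j < i → ∀ got, (e.state i).readers r ≠ .getData o got := by
    intro j r t h i hi
    obtain ⟨got₀, hst, -, -, -, v, acks, hnext⟩ := e.readPutData_inv h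
    have ho := (e.getData_origin hst).1
    induction i, hi using Nat.le_induction with
    | base => simp [hnext]
    | succ i hi ih =>
      intro got hg
      rcases (e.step i).reader_getData hg with ⟨got', hst', -⟩ | ⟨rfl, -⟩
      · exact ih got' hst'
      · omega
  obtain ⟨got₁, hst₁, -⟩ := e.readPutData_inv h
  obtain ⟨got₂, hst₂, -⟩ := e.readPutData_inv h'
  have h1 := (e.getData_origin hst₁).2.1
  have h2 := (e.getData_origin hst₂).2.1
  rw [h1] at h2
  cases h2
  rcases lt_trichotomy j j' with hlt | heq | hlt
  · exact absurd hst₂ (key j r t h j' hlt _)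
  · exact heq
  · exact absurd hst₁ (key j' r t' h' j hlt _)

theorem WriteTag.unique {e : Execution P R} {o : ℕ} {t t' : Tag W} (h : e.WriteTag o t)
    (h' : e.WriteTag o t') : t = t' := by
  obtain ⟨j, w, h⟩ := h
  obtain ⟨j', w', h'⟩ := h'
  obtain rfl := e.writePutData_unique h h'
  rw [h] at h'
  cases h'
  rfl

/-- The tag of the read `o`: the tag that the reader uses in put-data. -/
def ReadTag (o : ℕ) (t : Tag W) : Prop := ∃ j r, e.act j = .readPutData r o t

theorem ReadTag.unique {e : Execution P R} {o : ℕ} {t t' : Tag W} (h : e.ReadTag o t)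
    (h' : e.ReadTag o t') : t = t' := by
  obtain ⟨j, w, h⟩ := h
  obtain ⟨j', w', h'⟩ := h'
  obtain rfl := e.readPutData_unique h h'
  rw [h] at h'
  cases h'
  rfl

theorem isWrite_of_writePutData {j o : ℕ} {w : W} {t : Tag W}
    (h : e.act j = .writePutData w o t) : o < j ∧ ∃ v, e.act o = .invokeWrite w v := by
  obtain ⟨v₁, got₁, -, hst₁, -⟩ := e.writePutData_inv h
  have := e.getTag_origin hst₁
  exact ⟨this.1, v₁, this.2.1⟩

theorem isRead_of_readPutData {j o : ℕ} {r : R} {t : Tag W}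
    (h : e.act j = .readPutData r o t) : o < j ∧ e.act o = .invokeRead r := by
  obtain ⟨got₁, hst₁, -⟩ := e.readPutData_inv h
  have := e.getData_origin hst₁
  exact ⟨this.1, this.2.1⟩

/-- A writer completes each write before it invokes the next one. -/
theorem completes_before_next {o o' : ℕ} {w : W} {v v' : V} (h : e.act o = .invokeWrite w v)
    (h' : e.act o' = .invokeWrite w v') (hlt : o < o') : ∃ j < o', e.WriteCompletes o j := by
  have key : ∀ i, o < i → ((∃ v got, (e.state i).writers w = .getTag o v got) ∨
      (∃ g acks, (e.state i).writers w = .putData o g acks) ∨ (e.state i).writers w = .crashed) ∨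
      ∃ j < i, e.WriteCompletes o j := by
    intro i hi
    induction i, hi using Nat.le_induction with
    | base => exact .inl (.inl ⟨v, (e.invokeWrite_inv h).2⟩)
    | succ i hi ih =>
      rcases ih with ih | ⟨j, hj, hc⟩
      · rcases (e.step i).writer_busy ih with h1 | h1 | h1 | h1
        · exact .inl (.inl h1)
        · exact .inl (.inr (.inl h1))
        · exact .inl (.inr (.inr h1))
        · exact .inr ⟨i, by omega, w, h1⟩
      · exact .inr ⟨j, by omega, hc⟩
  rcases key o' hlt with h1 | h1
  · simp [(e.invokeWrite_inv h').1] at h1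
  · exact h1

/-- The lists that a read decodes have been received when it has all the lists it awaits. -/
theorem getData_frozen {T₂ j o : ℕ} {r r' : R} {got got' : Fin n → Option (CodedList W C)}
    (h : (e.state T₂).readers r = .getData o got) (hcard : (heard got).card = listQuorum n P.k)
    (hj : T₂ ≤ j) (h' : (e.state j).readers r' = .getData o got') : got' = got := by
  obtain ⟨ho, hact, -⟩ := e.getData_origin h
  obtain ⟨-, hact', -⟩ := e.getData_origin h'
  rw [hact] at hact'
  cases hact'
  induction j, hj using Nat.le_induction generalizing got' with
  | base =>
    rw [h] at h'
    cases h'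
    rfl
  | succ j hj ih =>
    rcases (e.step j).reader_getData h' with ⟨got₁, hst, h1, -⟩ | ⟨rfl, -⟩
    · obtain rfl := ih hst
      rcases h1 with h1 | h1
      · exact h1
      · omega
    · omega

end Operations

/-! ### Persistence of completed put-data phases -/

section Persistence

variable (e : Execution P R)

/-- The servers in `G` have consumed the coded elements of `v` with tag `t`, server `s` at step
`τ s`, and have stayed active since then up to and including time `T + 1`. -/
structure Anchor (t : Tag W) (v : V) (G : Finset (Fin n)) (τ : Fin n → ℕ) (T : ℕ) : Prop where
  card : n + P.k ≤ 2 * G.card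
  le : ∀ s ∈ G, τ s ≤ T
  consumed : ∀ s ∈ G, ∃ L, (e.state (τ s)).servers s = .active L ∧
    (e.state (τ s + 1)).servers s = .active (prune P.δ (L ∪ {(t, P.Φ v s)}))
  active : ∀ s ∈ G, ∀ i, τ s < i → i ≤ T + 1 → e.Active s i
  mem_tags : ∀ s ∈ G, t ∈ e.tagsBefore (τ s)

variable {e}

theorem Anchor.nonempty {t : Tag W} {v : V} {G : Finset (Fin n)} {τ : Fin n → ℕ} {T : ℕ}
    (h : e.Anchor t v G τ T) (hk : 1 ≤ P.k) : G.Nonempty := by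
  have := h.card
  exact Finset.card_pos.1 (by omega)

/-- The server is active on `(τ s, T + 1]` and inactive on `(o, i]`. If `o ≤ T`, the smaller of `i`
and `T + 1` would lie in both intervals. -/
theorem Anchor.lt_of_repair {t : Tag W} {v : V} {G : Finset (Fin n)} {τ : Fin n → ℕ} {T : ℕ}
    (h : e.Anchor t v G τ T) {s : Fin n} (hs : s ∈ G) {i o : ℕ} (hi : τ s < i)
    {got : Fin n → Option (CodedList W C)} (hst : (e.state i).servers s = .repair o got) :
    T < o := by
  obtain ⟨ho, -, hna, -⟩ := e.repair_origin hst
  by_contra hlt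
  rcases le_total i (T + 1) with hiT | hiT
  · exact hna i ho le_rfl (h.active s hs i hi hiT)
  · have := h.le s hs
    exact hna (T + 1) (by omega) hiT (h.active s hs (T + 1) (by omega) le_rfl)

/-- While there are at most `δ` larger tags, the active servers of an anchor keep its coded
elements. -/
theorem Anchor.mem {t : Tag W} {v : V} {G : Finset (Fin n)} {τ : Fin n → ℕ} {T : ℕ}
    (h : e.Anchor t v G τ T) (hk : 1 ≤ P.k) {B : ℕ}
    (hB : (e.tagsBefore B ∩ Set.Ioi t).encard ≤ P.δ) {i : ℕ} (hi : i ≤ B) {s : Fin n} (hs : s ∈ G)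
    (hτ : τ s < i) {L : CodedList W C} (hL : (e.state i).servers s = .active L) :
    (t, P.Φ v s) ∈ L := by
  -- In the repair case the hypothesis is needed for other servers of `G` at earlier times.
  induction i using Nat.strong_induction_on generalizing s L with
  | _ i ih =>
  cases i with
  | zero => omega
  | succ i =>
    have hin := e.tags_in_use hk i
    have hsub : e.tagsBefore i ⊆ e.tagsBefore B := e.tagsBefore_mono (by omega)
    rcases eq_or_lt_of_le (Nat.le_of_lt_succ hτ) with heq | hlt
    · obtain ⟨L₀, hL₀, hnext⟩ := h.consumed s hs
      have htag := h.mem_tags s hs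
      rw [heq] at hL₀ hnext htag
      rw [hL] at hnext
      cases hnext
      refine mem_prune (.inr rfl) ?_ hB
      rw [Set.image_union, Set.image_singleton, Set.union_singleton, Set.insert_subset_iff]
      exact ⟨hsub htag, (hin.1 s L₀ hL₀).trans hsub⟩
    · rcases (e.step i).server_active hL with ⟨L₀, hL₀, rfl | ⟨p', g, t', c, hmem, rfl⟩⟩ |
        ⟨o, got, -, hst, hq, rfl⟩
      · exact ih i (by omega) (by omega) hs hlt hL₀
      · refine mem_prune (.inl (ih i (by omega) (by omega) hs hlt hL₀)) ?_ hB
        rw [Set.image_union, Set.image_singleton, Set.union_singleton, Set.insert_subset_iff]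
        exact ⟨hsub (hin.2 g p' s t' c hmem), (hin.1 s L₀ hL₀).trans hsub⟩
      -- The repair starts after `T`, so each list it received from `G` was taken after that
      -- server's consumption and contains its element by induction; at least k such lists were
      -- received.
      · have hTo := h.lt_of_repair hs hlt hst
        obtain ⟨ho, -, -, hgot⟩ := e.repair_origin hst
        refine mem_prune ⟨v, decodable_of_forall_mem h.card hq fun s' hs' L' hL' => ?_, rfl⟩ ?_ hB
        · obtain ⟨j, hj, hji, hact⟩ := hgot s' L' hL'
          have := h.le s' hs'
          exact ih j (by omega) (by omega) hs' (by omega) hact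
        · rintro _ ⟨p, ⟨v', hd, -⟩, rfl⟩
          refine hsub (e.decodable_tag_in_use hk (fun s' L' hL' => ?_) hd)
          obtain ⟨j, -, hj, hact⟩ := hgot s' L' hL'
          exact ⟨j, hj, hact⟩

/-- A put-data phase with a full quorum of acks leaves an anchor. -/
theorem PutDataAt.anchor {α : ℝ} (hk : 1 ≤ P.k)
    (hα : (3 * (n : ℝ) + P.k) / (4 * n) ≤ α) (hN1 : e.N1 α) {p : Proc n W R} {g i : ℕ} {t : Tag W}
    {v : V} {acks : Finset (Fin n)} (h : e.PutDataAt p g i t v acks)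
    (hcard : acks.card = ackQuorum n P.k) : ∃ G τ T, T < i ∧ e.Anchor t v G τ T := by
  have hquorum := add_le_four_mul_ackQuorum n P.k
  have hne : acks.Nonempty := Finset.card_pos.1 (by omega)
  obtain ⟨S, τ, hS, hτ, hact⟩ := hN1 g (h.all_sent hne)
  have hn : 0 < n := by
    obtain ⟨s, -⟩ := hne
    exact s.pos
  have hScard : 3 * n + P.k ≤ 4 * S.card := by
    have h1 := Nat.le_ceil (α * n)
    rw [← hS] at h1
    have hn' : (0 : ℝ) < n := by exact_mod_cast hn
    rw [div_le_iff₀ (by positivity)] at hα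
    have : 3 * (n : ℝ) + P.k ≤ 4 * (S.card : ℝ) := by nlinarith
    exact_mod_cast this
  -- Twice (3n+k)/4 exceeds n by (n+k)/2: this is the size of the anchor.
  have hinter := card_add_card_le acks S
  have hGne : (acks ∩ S).Nonempty := Finset.card_pos.1 (by omega)
  have hτi : ∀ s ∈ acks ∩ S, τ s < i := fun s hs => by
    obtain ⟨h1, h2⟩ := Finset.mem_inter.1 hs
    obtain ⟨j, hj, hc⟩ := h.consumed s h1
    rwa [e.consume_unique (hτ s h2) hc]
  -- The time `T` is the last consumption within the intersection only. Servers of `S` outside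
  -- `acks` may consume after the phase has ended, whereas `T < i` is needed.
  obtain ⟨s₀, hs₀, hsup⟩ := Finset.exists_mem_eq_sup _ hGne τ
  have hcons : ∀ s ∈ acks ∩ S, ∃ L, (e.state (τ s)).servers s = .active L ∧
      (e.state (τ s + 1)).servers s = .active (prune P.δ (L ∪ {(t, P.Φ v s)})) ∧
      t ∈ e.tagsBefore (τ s) := fun s hs => by
    obtain ⟨q, m, L, L', b, hmem, h1, h2, hserve⟩ :=
      e.consume_inv (hτ s (Finset.mem_inter.1 hs).2)
    obtain ⟨-, M, hM, hMs⟩ := (e.req_origin _).2 _ _ _ _ hmem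
    obtain ⟨rfl, hm⟩ := h.starts.unique hM s
    rw [hMs] at hm
    subst hm
    refine ⟨L, h1, ?_, (e.tags_in_use hk _).2 _ _ _ _ _ hmem⟩
    cases hserve
    exact h2
  refine ⟨acks ∩ S, τ, τ s₀, hτi s₀ hs₀, ?_, fun s hs => ?_, fun s hs => ?_, fun s hs j h1 h2 => ?_,
    fun s hs => ?_⟩
  · omega
  · rw [← hsup]
    exact Finset.le_sup hs
  · obtain ⟨L, h1, h2, -⟩ := hcons s hs
    exact ⟨L, h1, h2⟩
  · have hs' := (Finset.mem_inter.1 hs).2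
    have := e.lt_of_consume (hτ s hs')
    exact hact s hs' s₀ (Finset.mem_inter.1 hs₀).2 j (by omega) h2
  · obtain ⟨L, -, -, h3⟩ := hcons s hs
    exact h3

theorem WriteCompletes.anchor {α : ℝ} (hk : 1 ≤ P.k)
    (hα : (3 * (n : ℝ) + P.k) / (4 * n) ≤ α) (hN1 : e.N1 α) {o j : ℕ}
    (h : e.WriteCompletes o j) :
    ∃ t v G τ T, e.WriteTag o t ∧ T < j ∧ e.Anchor t v G τ T := by
  obtain ⟨w, h⟩ := h
  obtain ⟨g, acks, hst, hcard⟩ := e.respondWrite_inv h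
  obtain ⟨t, v, -, -, -, hg, hput⟩ := e.writer_putData_origin hst
  obtain ⟨G, τ, T, hT, hanchor⟩ := hput.anchor hk hα hN1 hcard
  exact ⟨t, v, G, τ, T, ⟨g, w, hg⟩, hT, hanchor⟩

theorem ReadCompletes.anchor {α : ℝ} (hk : 1 ≤ P.k)
    (hα : (3 * (n : ℝ) + P.k) / (4 * n) ≤ α) (hN1 : e.N1 α) {o j : ℕ} {v : V}
    (h : e.ReadCompletes o j v) :
    ∃ t G τ T, e.ReadTag o t ∧ T < j ∧ e.Anchor t v G τ T := by
  obtain ⟨r, h⟩ := h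
  obtain ⟨g, acks, hst, hcard⟩ := e.respondRead_inv h
  obtain ⟨t, got, -, -, -, hg, -, -, hput⟩ := e.reader_putData_origin hst
  obtain ⟨G, τ, T, hT, hanchor⟩ := hput.anchor hk hα hN1 hcard
  exact ⟨t, G, τ, T, ⟨g, r, hg⟩, hT, hanchor⟩

/-- A read or repair that satisfies the concurrency bound and begins after an anchor has been
established can decode a tag at least as large, above which there are at most `δ` tags. -/
theorem Anchor.exists_decodable {α : ℝ} (hk : 1 ≤ P.k)
    (hα : (3 * (n : ℝ) + P.k) / (4 * n) ≤ α) (hN1 : e.N1 α) {T₁ T₂ : ℕ}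
    (hδ : (e.concurrentWrites T₁ T₂).encard ≤ P.δ) {t : Tag W} {v : V} {G : Finset (Fin n)}
    {τ : Fin n → ℕ} {T : ℕ} (h : e.Anchor t v G τ T) (hT : T < T₁)
    {got : Fin n → Option (CodedList W C)} (hq : (heard got).card = listQuorum n P.k)
    (hgot : ∀ s L, got s = some L → ∃ j, T₁ < j ∧ j < T₂ ∧ (e.state j).servers s = .active L) :
    ∃ t' v', t ≤ t' ∧ Decodable P got t' v' ∧ (e.tagsBefore T₂ ∩ Set.Ioi t').encard ≤ P.δ := by
  -- The tag `t` itself is included because its anchor may stem from a read whose tag belongs to no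
  -- completed write.
  let X : Set (Tag W) := {t' | t' = t ∨ ∃ o j, e.WriteCompletes o j ∧ j < T₁ ∧ e.WriteTag o t'}
  have hXanchor : ∀ t' ∈ X, ∃ v' G' τ' T', T' < T₁ ∧ e.Anchor t' v' G' τ' T' := by
    rintro t' (rfl | ⟨o, j, hc, hj, ht⟩)
    · exact ⟨v, G, τ, T, hT, h⟩
    · obtain ⟨t'', v', G', τ', T', ht', hT', h'⟩ := hc.anchor hk hα hN1
      obtain rfl := ht.unique ht'
      exact ⟨v', G', τ', T', by omega, h'⟩
  have hXfin : X.Finite := by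
    refine (e.finite_tagsBefore T₁).subset fun t' ht' => ?_
    obtain ⟨v', G', τ', T', hT', h'⟩ := hXanchor t' ht'
    obtain ⟨s, hs⟩ := h'.nonempty hk
    have := h'.le s hs
    exact e.tagsBefore_mono (by omega) (h'.mem_tags s hs)
  obtain ⟨t', ht', hmax⟩ := hXfin.exists_maximal ⟨t, .inl rfl⟩
  have hmax' : ∀ t'' ∈ X, t'' ≤ t' := fun t'' h'' => by
    rcases le_total t'' t' with h1 | h1
    exacts [h1, hmax h'' h1]
  obtain ⟨v', G', τ', T', hT', h'⟩ := hXanchor t' ht'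
  have hbound : (e.tagsBefore T₂ ∩ Set.Ioi t').encard ≤ P.δ := by
    classical
    -- The bound counts writes, while pruning counts tags. Every tag in use above `t'` is the image
    -- under `f` of a concurrent write; `P.t₀` is not above `t'`.
    let f : ℕ → Tag W := fun l => if hl : ∃ t, e.WriteTag l t then hl.choose else t
    have hf : ∀ l t, e.WriteTag l t → f l = t := fun l t hl => by
      have hex : ∃ t, e.WriteTag l t := ⟨t, hl⟩
      simp only [f, dif_pos hex]
      exact hex.choose_spec.unique hl
    refine (Set.encard_le_encard ?_).trans
      ((Set.encard_image_le f (e.concurrentWrites T₁ T₂)).trans hδ)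
    rintro t'' ⟨hin, hlt⟩
    rcases hin with rfl | ⟨j, hj, w, o, hact⟩
    · obtain ⟨s, hs⟩ := h'.nonempty hk
      exact absurd hlt (e.t₀_le_of_mem_tagsBefore hk (h'.mem_tags s hs)).not_gt
    · obtain ⟨ho, v'', hv⟩ := e.isWrite_of_writePutData hact
      refine ⟨o, ⟨⟨v'', w, hv⟩, by omega, t'', ⟨j, w, hact⟩, fun o' j' t₁ hc hj' ht₁ => ?_⟩,
        hf o t'' ⟨j, w, hact⟩⟩
      exact (hmax' t₁ (.inr ⟨o', j', hc, hj', ht₁⟩)).trans_lt hlt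
  refine ⟨t', v', hmax' t (.inl rfl), decodable_of_forall_mem h'.card hq fun s hs L hL => ?_,
    hbound⟩
  obtain ⟨j, hj, hjT, hact⟩ := hgot s L hL
  have := h'.le s hs
  exact h'.mem hk hbound hjT.le hs (by omega) hact

/-- The active servers of an anchor keep a tag that is at least as large. -/
theorem Anchor.exists_ge {α : ℝ} (hk : 1 ≤ P.k)
    (hα : (3 * (n : ℝ) + P.k) / (4 * n) ≤ α) (hN1 : e.N1 α) (hδ : e.ConcurrencyAtMost P.δ)
    {t : Tag W} {v : V} {G : Finset (Fin n)} {τ : Fin n → ℕ} {T : ℕ} (h : e.Anchor t v G τ T)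
    {i : ℕ} {s : Fin n} (hs : s ∈ G) (hτ : τ s < i) {L : CodedList W C}
    (hL : (e.state i).servers s = .active L) : ∃ p ∈ L, t ≤ p.1 := by
  induction i generalizing L with
  | zero => omega
  | succ i ih =>
    have hin := e.tags_in_use hk i
    have hfin := e.finite_tagsBefore i
    rcases eq_or_lt_of_le (Nat.le_of_lt_succ hτ) with heq | hlt
    · obtain ⟨L₀, hL₀, hnext⟩ := h.consumed s hs
      have htag := h.mem_tags s hs
      rw [heq] at hL₀ hnext htag
      rw [hL] at hnext
      cases hnext
      refine exists_ge_mem_prune (p := (t, P.Φ v s)) (hfin.subset ?_) (.inr rfl)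
      rw [Set.image_union, Set.image_singleton, Set.union_singleton, Set.insert_subset_iff]
      exact ⟨htag, hin.1 s L₀ hL₀⟩
    · rcases (e.step i).server_active hL with ⟨L₀, hL₀, rfl | ⟨p', g, t', c, hmem, rfl⟩⟩ |
        ⟨o, got, ha, hst, hq, rfl⟩
      · exact ih hlt hL₀
      · obtain ⟨p, hp, hle⟩ := ih hlt hL₀
        have hsub : Prod.fst '' (L₀ ∪ {(t', c)}) ⊆ e.tagsBefore i := by
          rw [Set.image_union, Set.image_singleton, Set.union_singleton, Set.insert_subset_iff]
          exact ⟨hin.2 g p' s t' c hmem, hin.1 s L₀ hL₀⟩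
        obtain ⟨q, hq, hle'⟩ := exists_ge_mem_prune (δ := P.δ) (hfin.subset hsub) (.inl hp)
        exact ⟨q, hq, hle.trans hle'⟩
      -- The repair may lose `t` itself, but it decodes some `t' ≥ t` with at most `δ` larger tags
      -- in use, and this one survives pruning.
      · have hTo := h.lt_of_repair hs hlt hst
        obtain ⟨ho, hinit, -, hgot⟩ := e.repair_origin hst
        obtain ⟨t', v', hle, hd, hbound⟩ := h.exists_decodable hk hα hN1
          (hδ o i (.inr ⟨s, hinit, ha⟩)) hTo hq hgot
        refine ⟨(t', P.Φ v' s), mem_prune ⟨v', hd, rfl⟩ ?_ hbound, hle⟩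
        rintro _ ⟨p, ⟨v'', hd', -⟩, rfl⟩
        refine e.decodable_tag_in_use hk (fun s' L' hL' => ?_) hd'
        obtain ⟨j, -, hj, hact⟩ := hgot s' L' hL'
        exact ⟨j, hj, hact⟩

/-- A write that is invoked after an anchor has been established uses a larger tag. -/
theorem Anchor.lt_writeTag {α : ℝ} (hk : 1 ≤ P.k)
    (hα : (3 * (n : ℝ) + P.k) / (4 * n) ≤ α) (hN1 : e.N1 α) (hδ : e.ConcurrencyAtMost P.δ)
    {t : Tag W} {v : V} {G : Finset (Fin n)} {τ : Fin n → ℕ} {T : ℕ} (h : e.Anchor t v G τ T)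
    {o : ℕ} {t' : Tag W} (ho : T < o) (ht' : e.WriteTag o t') : t < t' := by
  obtain ⟨j, w, hact⟩ := ht'
  obtain ⟨v', got, tmax, hst, hmaj, ⟨-, hmax⟩, rfl, -⟩ := e.writePutData_inv hact
  have hinter := card_add_card_le (heard got) G
  have hG := h.card
  -- A majority together with at least (n+1)/2 servers exceeds n, so some responder belongs to `G`.
  obtain ⟨s, hs⟩ := Finset.card_pos.1
    (by unfold majority at hmaj; omega : 0 < (heard got ∩ G).card)
  obtain ⟨hs1, hs2⟩ := Finset.mem_inter.1 hs
  obtain ⟨t₁, ht₁⟩ := mem_heard.1 hs1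
  obtain ⟨i, L, hoi, -, hL, hmt⟩ := (e.getTag_origin hst).2.2 s t₁ ht₁
  have := h.le s hs2
  obtain ⟨p, hp, hle⟩ := h.exists_ge hk hα hN1 hδ hs2 (by omega : τ s < i) hL
  have h1 : t ≤ t₁ := by
    rcases hmt with ⟨-, hub⟩ | ⟨rfl, -⟩
    · exact hle.trans (hub ⟨p, hp, rfl⟩)
    · exact absurd hp (Set.notMem_empty p)
  have h2 : t ≤ tmax := h1.trans (hmax ⟨s, ht₁⟩)
  rw [Prod.Lex.le_iff] at h2
  rw [Prod.Lex.lt_iff]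
  left
  simp only [ofLex_toLex]
  rcases h2 with h1 | ⟨h1, -⟩ <;> omega

/-- A read that is invoked after an anchor has been established uses a tag at least as large. -/
theorem Anchor.le_readTag {α : ℝ} (hk : 1 ≤ P.k)
    (hα : (3 * (n : ℝ) + P.k) / (4 * n) ≤ α) (hN1 : e.N1 α) (hδ : e.ConcurrencyAtMost P.δ)
    {t : Tag W} {v : V} {G : Finset (Fin n)} {τ : Fin n → ℕ} {T : ℕ} (h : e.Anchor t v G τ T)
    {o : ℕ} {t' : Tag W} (ho : T < o) (ht' : e.ReadTag o t') : t ≤ t' := by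
  classical
  obtain ⟨j, r, hact⟩ := ht'
  obtain ⟨got, hst, hq, -, hmax, -⟩ := e.readPutData_inv hact
  -- Concurrency is bounded up to the first moment at which all lists are present, possibly before
  -- the decoding step `j`; the lists do not change in between.
  have hex : ∃ i, e.ReadHasLists o i := ⟨j, r, got, hst, hq⟩
  have hfirst : e.ReadHasLists o (Nat.find hex) := Nat.find_spec hex
  have hle : Nat.find hex ≤ j := Nat.find_min' hex ⟨r, got, hst, hq⟩
  have hvalid : e.ValidRead o (Nat.find hex) :=
    ⟨⟨r, (e.getData_origin hst).2.1⟩, hfirst, fun i hi => Nat.find_min' hex hi⟩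
  obtain ⟨r', got', hst', hq'⟩ := hfirst
  obtain rfl := e.getData_frozen hst' hq' hle hst
  obtain ⟨t'', v'', h1, hd, -⟩ := h.exists_decodable hk hα hN1 (hδ _ _ (.inl hvalid)) ho hq
    (e.getData_origin hst').2.2
  exact h1.trans (hmax t'' v'' hd)

end Persistence

end Execution

/-! ### Unique decoding and serialization points -/

/-- Any `k` coded elements determine the value. -/
theorem LinearMDSCode.eq_of_encode_eq {F : Type*} [Field F] {k : ℕ} {ι V : Type*}
    (code : LinearMDSCode F n k ι V) {S : Finset (Fin n)} (hS : S.card = k) {v u : V}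
    (h : ∀ s ∈ S, code.encode v s = code.encode u s) : v = u := by
  refine code.elems_injective (funext fun j => funext fun stripe => ?_)
  refine congrFun (code.mds S hS (a₁ := fun j => code.elems v j stripe)
    (a₂ := fun j => code.elems u j stripe) (funext fun s => ?_)) j
  exact congrFun (h s s.2) stripe

/-- If each point of `A` has finitely many predecessors in the order given by `key`, there are
real-valued points, increasing in this order, such that the point of `a` lies after `a` and before
every integer larger than `a` and all its predecessors. -/
theorem exists_serialization_points {K : Type*} [LinearOrder K] (A : Set ℕ) (key : ℕ → K)
    (hfin : ∀ a ∈ A, {b ∈ A | key b ≤ key a}.Finite) :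
    ∃ pt : ℕ → ℝ, (∀ a ∈ A, ∀ b ∈ A, key a < key b → pt a < pt b) ∧
      (∀ a ∈ A, (a : ℝ) < pt a) ∧
      ∀ a ∈ A, ∀ j : ℕ, (∀ b ∈ A, key b ≤ key a → b < j) → pt a < j := by
  classical
  let D : ℕ → Finset ℕ := fun a => if h : a ∈ A then (hfin a h).toFinset else ∅
  have hD : ∀ a ∈ A, ∀ b, b ∈ D a ↔ b ∈ A ∧ key b ≤ key a := fun a ha b => by
    simp [D, ha]
  have hself : ∀ a ∈ A, a ∈ D a := fun a ha => (hD a ha a).2 ⟨ha, le_rfl⟩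
  -- The integer part is the latest predecessor, which puts the point before every integer beyond
  -- all predecessors. The fractional part, at least 1/2 on `A`, grows with the number of
  -- predecessors and separates points with equal integer part.
  refine ⟨fun a => ((D a).sup id : ℕ) + (1 - 1 / (((D a).card : ℝ) + 1)), ?_, ?_, ?_⟩
  · intro a ha b hb hab
    have hsub : D a ⊆ D b := fun c hc => by
      obtain ⟨h1, h2⟩ := (hD a ha c).1 hc
      exact (hD b hb c).2 ⟨h1, h2.trans hab.le⟩
    have hss : D a ⊂ D b := by
      refine Finset.ssubset_iff_subset_ne.2 ⟨hsub, fun heq => ?_⟩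
      have := hself b hb
      rw [← heq, hD a ha] at this
      exact hab.not_ge this.2
    have hcard : ((D a).card : ℝ) < (D b).card := by exact_mod_cast Finset.card_lt_card hss
    have hsup : (((D a).sup id : ℕ) : ℝ) ≤ ((D b).sup id : ℕ) :=
      Nat.cast_le.2 (Finset.sup_mono hsub)
    have hdiv : 1 / (((D b).card : ℝ) + 1) < 1 / (((D a).card : ℝ) + 1) :=
      one_div_lt_one_div_of_lt (Nat.cast_add_one_pos _) (by linarith)
    simp only
    linarith
  · intro a ha
    have hpos : (0 : ℝ) < (D a).card := by exact_mod_cast Finset.card_pos.2 ⟨a, hself a ha⟩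
    have hle : (a : ℝ) ≤ ((D a).sup id : ℕ) :=
      Nat.cast_le.2 (Finset.le_sup (f := id) (hself a ha))
    have hdiv : 1 / (((D a).card : ℝ) + 1) < 1 := by
      rw [div_lt_one (Nat.cast_add_one_pos _)]
      linarith
    simp only
    linarith
  · intro a ha j hj
    have hlt : ((D a).sup id : ℕ) < j := by
      refine (Finset.sup_lt_iff ?_).2 fun b hb => ?_
      · exact (Nat.zero_le a).trans_lt (hj a ha le_rfl)
      · obtain ⟨h1, h2⟩ := (hD a ha b).1 hb
        exact hj b h1 h2
    have hle : (((D a).sup id : ℕ) : ℝ) + 1 ≤ j := by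
      rw [← Nat.cast_add_one]
      exact Nat.cast_le.2 hlt
    have hdiv : 0 < 1 / (((D a).card : ℝ) + 1) :=
      one_div_pos.2 (Nat.cast_add_one_pos _)
    simp only
    linarith

namespace Execution

/-! ### Tags determine writes and values -/

section Values

variable {e : Execution P R}

/-- Equal tags have the same writer component, and a writer completes one write before it invokes
the next; the anchor of the first forces a larger tag on the second. -/
theorem WriteTag.injective {α : ℝ} (hk : 1 ≤ P.k)
    (hα : (3 * (n : ℝ) + P.k) / (4 * n) ≤ α) (hN1 : e.N1 α) (hδ : e.ConcurrencyAtMost P.δ)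
    {o o' : ℕ} {t : Tag W} (h : e.WriteTag o t) (h' : e.WriteTag o' t) : o = o' := by
  have key : ∀ o o', e.WriteTag o t → e.WriteTag o' t → ¬ o < o' := by
    intro o o' h h' hlt
    obtain ⟨j, w, hj⟩ := id h
    obtain ⟨j', w', hj'⟩ := id h'
    obtain ⟨v, got, tmax, -, -, -, ht, -⟩ := e.writePutData_inv hj
    obtain ⟨v', got', tmax', -, -, -, ht', -⟩ := e.writePutData_inv hj'
    rw [ht] at ht'
    obtain rfl : w = w' := congrArg Prod.snd (toLex.injective ht')
    obtain ⟨-, v, hv⟩ := e.isWrite_of_writePutData hj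
    obtain ⟨-, v', hv'⟩ := e.isWrite_of_writePutData hj'
    obtain ⟨l, hl, hc⟩ := e.completes_before_next hv hv' hlt
    obtain ⟨t', v₁, G, τ, T, ht₁, hT, hanchor⟩ := hc.anchor hk hα hN1
    obtain rfl := h.unique ht₁
    exact lt_irrefl _ (hanchor.lt_writeTag hk hα hN1 hδ (by omega) h')
  have h1 := key o o' h h'
  have h2 := key o' o h' h
  omega

variable (e) in
/-- `v` is the value that is written with tag `t`. -/
def HasValue (t : Tag W) (v : V) : Prop :=
  (t = P.t₀ ∧ v = P.v₀) ∨ ∃ o, e.WriteTag o t ∧ e.IsWrite o v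

theorem HasValue.unique {α : ℝ} (hk : 1 ≤ P.k)
    (hα : (3 * (n : ℝ) + P.k) / (4 * n) ≤ α) (hN1 : e.N1 α) (hδ : e.ConcurrencyAtMost P.δ)
    {t : Tag W} {v u : V} (h : e.HasValue t v) (h' : e.HasValue t u) : v = u := by
  have hne : ∀ o, ¬ e.WriteTag o P.t₀ := fun o ⟨j, w, hj⟩ =>
    lt_irrefl _ (e.t₀_lt_of_writePutData hk hj)
  rcases h with ⟨rfl, rfl⟩ | ⟨o, ho, w, hv⟩
  · rcases h' with ⟨-, rfl⟩ | ⟨o, ho, -⟩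
    exacts [rfl, absurd ho (hne o)]
  · rcases h' with ⟨rfl, -⟩ | ⟨o', ho', w', hv'⟩
    · exact absurd ho (hne o)
    · obtain rfl := ho.injective hk hα hN1 hδ ho'
      rw [hv] at hv'
      cases hv'
      rfl

/-- The invariant is that every stored or transmitted element encodes the value written with its
tag. Decoding preserves it: the k elements used encode one and the same value, because a tag has
only one, and determine it. -/
theorem ReadCompletes.hasValue {α : ℝ} (hk : 1 ≤ P.k)
    (hα : (3 * (n : ℝ) + P.k) / (4 * n) ≤ α) (hN1 : e.N1 α) (hδ : e.ConcurrencyAtMost P.δ)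
    (hmds : ∀ S : Finset (Fin n), S.card = P.k → ∀ v u : V,
      (∀ s ∈ S, P.Φ v s = P.Φ u s) → v = u)
    {o j : ℕ} {v : V} (h : e.ReadCompletes o j v) :
    o < j ∧ ∃ t, e.ReadTag o t ∧ e.HasValue t v := by
  have hdec : ∀ t v (S : Finset (Fin n)), S.card = P.k →
      (∀ s ∈ S, ∃ u, e.HasValue t u ∧ P.Φ v s = P.Φ u s) → e.HasValue t v := by
    intro t v S hS hmem
    obtain ⟨s₀, hs₀⟩ := Finset.card_pos.1 (by omega : 0 < S.card)
    obtain ⟨u, hu, -⟩ := hmem s₀ hs₀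
    suffices v = u by rwa [this]
    refine hmds S hS v u fun s hs => ?_
    obtain ⟨u', hu', heq⟩ := hmem s hs
    rwa [hu'.unique hk hα hN1 hδ hu] at heq
  have hpairs := e.forall_pairs (fun _ s t c => ∃ u, e.HasValue t u ∧ c = P.Φ u s)
    (fun _ _ _ _ _ _ h => h) (fun s => ⟨P.v₀, .inl ⟨rfl, rfl⟩, rfl⟩)
    (fun j w o t v hj ho s => ⟨v, .inr ⟨o, ⟨j, w, hj⟩, w, ho⟩, rfl⟩)
    (fun _ t v S hS hmem s => ⟨v, hdec t v S hS hmem, rfl⟩)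
  obtain ⟨r, h⟩ := h
  obtain ⟨g, acks, hst, -⟩ := e.respondRead_inv h
  obtain ⟨t, got, hog, hgj, -, hg, hst', ⟨S, hS, hmem⟩, -⟩ := e.reader_putData_origin hst
  refine ⟨by omega, t, ⟨g, r, hg⟩, hdec t v S hS fun s hs => ?_⟩
  obtain ⟨L, hL, hp⟩ := hmem s hs
  obtain ⟨i, -, -, hact⟩ := (e.getData_origin hst').2.2 s L hL
  exact (hpairs i).1 s L hact _ hp

end Values

/-! ### Atomicity -/

section Atomicity

variable (e : Execution P R)

/-- A write or read `o` with tag `t` completes at step `j`. -/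
def Completes (o j : ℕ) (t : Tag W) : Prop :=
  (e.WriteCompletes o j ∧ e.WriteTag o t) ∨ ((∃ v, e.ReadCompletes o j v) ∧ e.ReadTag o t)

variable {e}

theorem WriteCompletes.exists_tag {o j : ℕ} (h : e.WriteCompletes o j) :
    o < j ∧ ∃ t, e.WriteTag o t := by
  obtain ⟨w, h⟩ := h
  obtain ⟨g, acks, hst, hcard⟩ := e.respondWrite_inv h
  obtain ⟨t, v, h1, h2, -, hg, -⟩ := e.writer_putData_origin hst
  exact ⟨by omega, t, g, w, hg⟩

theorem WriteTag.isWrite {o : ℕ} {t : Tag W} (h : e.WriteTag o t) : ∃ v, e.IsWrite o v := by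
  obtain ⟨j, w, h⟩ := h
  obtain ⟨-, v, hv⟩ := e.isWrite_of_writePutData h
  exact ⟨v, w, hv⟩

theorem ReadTag.isRead {o : ℕ} {t : Tag W} (h : e.ReadTag o t) : e.IsRead o := by
  obtain ⟨j, r, h⟩ := h
  exact ⟨r, (e.isRead_of_readPutData h).2⟩

theorem IsWrite.not_isRead {o : ℕ} {v : V} (h : e.IsWrite o v) : ¬ e.IsRead o := by
  rintro ⟨r, hr⟩
  obtain ⟨w, hw⟩ := h
  rw [hr] at hw
  cases hw

theorem Completes.anchor {α : ℝ} (hk : 1 ≤ P.k)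
    (hα : (3 * (n : ℝ) + P.k) / (4 * n) ≤ α) (hN1 : e.N1 α) {o j : ℕ} {t : Tag W}
    (h : e.Completes o j t) : ∃ v G τ T, T < j ∧ e.Anchor t v G τ T := by
  rcases h with ⟨hc, ht⟩ | ⟨⟨v, hc⟩, ht⟩
  · obtain ⟨t', v, G, τ, T, ht', hT, h⟩ := hc.anchor hk hα hN1
    obtain rfl := ht.unique ht'
    exact ⟨v, G, τ, T, hT, h⟩
  · obtain ⟨t', G, τ, T, ht', hT, h⟩ := hc.anchor hk hα hN1
    obtain rfl := ht.unique ht'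
    exact ⟨v, G, τ, T, hT, h⟩

theorem atomic_of_n1 {α : ℝ} (hk : 1 ≤ P.k)
    (hα : (3 * (n : ℝ) + P.k) / (4 * n) ≤ α) (hN1 : e.N1 α) (hδ : e.ConcurrencyAtMost P.δ)
    (hmds : ∀ S : Finset (Fin n), S.card = P.k → ∀ v u : V,
      (∀ s ∈ S, P.Φ v s = P.Φ u s) → v = u) : e.Atomic := by
  classical
  let tag : ℕ → Tag W := fun o =>
    if h : ∃ t, e.WriteTag o t ∨ e.ReadTag o t then h.choose else P.t₀
  have htag : ∀ o t, e.WriteTag o t ∨ e.ReadTag o t → tag o = t := fun o t h => by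
    have hex : ∃ t, e.WriteTag o t ∨ e.ReadTag o t := ⟨t, h⟩
    simp only [tag, dif_pos hex]
    rcases hex.choose_spec with h1 | h1 <;> rcases h with h2 | h2
    · exact h1.unique h2
    · exact absurd h2.isRead h1.isWrite.choose_spec.not_isRead
    · exact absurd h1.isRead h2.isWrite.choose_spec.not_isRead
    · exact h1.unique h2
  -- An incomplete write is kept only if a completed operation carries its tag, that is, if some
  -- completed read has used it. Without such a completion its predecessors might be infinite in
  -- number. Incomplete reads are dropped.
  let A : Set ℕ := {o | (e.WriteTag o (tag o) ∨ e.ReadTag o (tag o) ∧ ∃ j, e.Completes o j (tag o)) ∧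
    ∃ o' j, e.Completes o' j (tag o)}
  let ret : ℕ → V := fun o => if h : ∃ v, e.HasValue (tag o) v then h.choose else P.v₀
  have hret : ∀ o v, e.HasValue (tag o) v → ret o = v := fun o v h => by
    have hex : ∃ v, e.HasValue (tag o) v := ⟨v, h⟩
    simp only [ret, dif_pos hex]
    exact hex.choose_spec.unique hk hα hN1 hδ h
  have hwriteA : ∀ o j, e.WriteCompletes o j → o ∈ A ∧ o < j ∧ e.Completes o j (tag o) := by
    intro o j hc
    obtain ⟨hlt, t, ht⟩ := hc.exists_tag
    rw [← htag o t (.inl ht)] at ht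
    exact ⟨⟨.inl ht, o, j, .inl ⟨hc, ht⟩⟩, hlt, .inl ⟨hc, ht⟩⟩
  have hreadA : ∀ o j v, e.ReadCompletes o j v →
      o ∈ A ∧ o < j ∧ e.Completes o j (tag o) ∧ e.HasValue (tag o) v := by
    intro o j v hc
    obtain ⟨hlt, t, ht, hv⟩ := hc.hasValue hk hα hN1 hδ hmds
    obtain rfl := htag o t (.inr ht)
    have hc' : e.Completes o j (tag o) := .inr ⟨⟨v, hc⟩, ht⟩
    exact ⟨⟨.inr ⟨ht, j, hc'⟩, o, j, hc'⟩, hlt, hc', hv⟩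
  have hAwrite : ∀ o ∈ A, (∃ v, e.IsWrite o v) → e.WriteTag o (tag o) := by
    rintro o ⟨h | ⟨h, -⟩, -⟩ ⟨v, hv⟩
    exacts [h, absurd h.isRead hv.not_isRead]
  have hAread : ∀ o ∈ A, e.IsRead o → e.ReadTag o (tag o) ∧ ∃ j v, e.ReadCompletes o j v := by
    rintro o ⟨h | ⟨h, j, hc⟩, -⟩ hr
    · exact absurd hr h.isWrite.choose_spec.not_isRead
    · refine ⟨h, j, ?_⟩
      rcases hc with ⟨-, hc⟩ | ⟨hc, -⟩
      · exact absurd hr hc.isWrite.choose_spec.not_isRead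
      · exact hc
  have hAop : ∀ o ∈ A, (∃ v, e.IsWrite o v) ∨ e.IsRead o := by
    rintro o ⟨h | ⟨h, -⟩, -⟩
    exacts [.inl h.isWrite, .inr h.isRead]
  -- the operations after the completion of one with tag `t` and with no larger tag are reads
  have hafter : ∀ o j t b, e.Completes o j t → b ∈ A → j < b → tag b ≤ t →
      e.IsRead b ∧ tag b = t := by
    intro o j t b hc hb hjb hle
    obtain ⟨v, G, τ, T, hT, hanchor⟩ := hc.anchor hk hα hN1
    rcases hAop b hb with hw | hr
    · have := hanchor.lt_writeTag hk hα hN1 hδ (by omega) (hAwrite b hb hw)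
      exact absurd hle this.not_ge
    · exact ⟨hr, hle.antisymm
        (hanchor.le_readTag hk hα hN1 hδ (by omega) (hAread b hb hr).1)⟩
  -- Rank 0 places a write before all reads with its tag; the shift by one keeps a read invoked at
  -- step 0 apart from it.
  let rank : ℕ → ℕ := fun o => if e.IsRead o then o + 1 else 0
  have hrank_read : ∀ o, e.IsRead o → rank o = o + 1 := fun o h => by simp [rank, h]
  have hrank_write : ∀ o, (∃ v, e.IsWrite o v) → rank o = 0 := fun o ⟨v, h⟩ => by
    simp [rank, h.not_isRead]
  have hrank_le : ∀ o, rank o ≤ o + 1 := fun o => by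
    simp only [rank]
    split_ifs <;> omega
  let key : ℕ → Tag W ×ₗ ℕ := fun o => toLex (tag o, rank o)
  have hkey_le : ∀ a b, key b ≤ key a ↔ tag b < tag a ∨ tag b = tag a ∧ rank b ≤ rank a :=
    fun a b => Prod.Lex.le_iff
  have hkey_lt : ∀ a b, key b < key a ↔ tag b < tag a ∨ tag b = tag a ∧ rank b < rank a :=
    fun a b => Prod.Lex.lt_iff
  -- A predecessor of `a` invoked after the completion of an operation with the tag of `a` can only
  -- be a read with this same tag, so comparing ranks gives `b ≤ a`. Used with `o = a` for real-time
  -- order, and with any such `o` for finiteness.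
  have hpred : ∀ o j a b, e.Completes o j (tag a) → b ∈ A → key b ≤ key a → j < b → b ≤ a := by
    intro o j a b hc hb hle hjb
    rw [hkey_le] at hle
    have htle : tag b ≤ tag a := by
      rcases hle with h | ⟨h, -⟩
      exacts [h.le, h.le]
    obtain ⟨hr, heq⟩ := hafter o j (tag a) b hc hb hjb htle
    rcases hle with h | ⟨-, h⟩
    · exact absurd heq h.ne
    · rw [hrank_read b hr] at h
      have := hrank_le a
      omega
  have hfin : ∀ a ∈ A, {b ∈ A | key b ≤ key a}.Finite := by
    rintro a ⟨-, o, j, hc⟩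
    refine (Set.finite_Iic (max j a)).subset ?_
    rintro b ⟨hb, hle⟩
    rw [Set.mem_Iic]
    by_contra hlt
    have h1 : j < b := by omega
    have := hpred o j a b hc hb hle h1
    omega
  obtain ⟨pt, hmono, hgt, hlt⟩ := exists_serialization_points A key hfin
  have hinj : ∀ a ∈ A, ∀ b ∈ A, key a = key b → a = b := by
    intro a ha b hb heq
    have heq' := Prod.ext_iff.1 (toLex.injective heq)
    obtain ⟨h1, h2⟩ : tag a = tag b ∧ rank a = rank b := heq'
    rcases hAop a ha with hwa | hra <;> rcases hAop b hb with hwb | hrb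
    · have := hAwrite b hb hwb
      rw [← h1] at this
      exact (hAwrite a ha hwa).injective hk hα hN1 hδ this
    · rw [hrank_write a hwa, hrank_read b hrb] at h2
      omega
    · rw [hrank_read a hra, hrank_write b hwb] at h2
      omega
    · rw [hrank_read a hra, hrank_read b hrb] at h2
      omega
  refine ⟨A, ret, pt, hAop, fun o j hc => (hwriteA o j hc).1, fun o j v hc => ?_, ?_, hgt, ?_, ?_⟩
  · obtain ⟨h1, -, -, h2⟩ := hreadA o j v hc
    exact ⟨h1, hret o v h2⟩
  · intro a ha b hb heq
    rcases lt_trichotomy (key a) (key b) with h | h | h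
    · exact absurd heq (hmono a ha b hb h).ne
    · exact hinj a ha b hb h
    · exact absurd heq (hmono b hb a ha h).ne'
  · intro o ho j hc
    have hc' : o < j ∧ e.Completes o j (tag o) := by
      rcases hc with hc | ⟨v, hc⟩
      · exact (hwriteA o j hc).2
      · exact ⟨(hreadA o j v hc).2.1, (hreadA o j v hc).2.2.1⟩
    refine hlt o ho j fun b hb hle => ?_
    by_contra hjb
    -- Step `j` is a response and `b` is an invocation step, so the order of the two is strict.
    have hne : j ≠ b := by
      rintro rfl
      rcases hAop j hb with ⟨v, w, h1⟩ | ⟨r, h1⟩ <;>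
        rcases hc with ⟨w', h2⟩ | ⟨v', r', h2⟩ <;>
        · rw [h1] at h2
          cases h2
    have := hpred o j o b hc'.2 hb hle (by omega)
    omega
  · intro o ho hr
    obtain ⟨-, j, v, hc⟩ := hAread o ho hr
    obtain ⟨-, -, hcomp, hval⟩ := hreadA o j v hc
    rw [hret o v hval]
    rcases hval with ⟨ht, rfl⟩ | ⟨o', ho', hv⟩
    · refine .inl ⟨fun o' ho' hw => ?_, rfl⟩
      refine hmono o ho o' ho' ((hkey_lt _ _).2 (.inl ?_))
      obtain ⟨l, w, hl⟩ := hAwrite o' ho' hw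
      rw [ht]
      exact e.t₀_lt_of_writePutData hk hl
    · have ht : tag o' = tag o := htag o' _ (.inl ho')
      -- The write may be incomplete, but the completion of this read admits it to `A`.
      have hmem : o' ∈ A := by
        refine ⟨.inl ?_, o, j, ?_⟩ <;> rw [ht]
        exacts [ho', hcomp]
      refine .inr ⟨o', hmem, hv, hmono o' hmem o ho ((hkey_lt _ _).2 (.inr ⟨ht, ?_⟩)),
        fun o'' hmem'' hw'' => ?_⟩
      · rw [hrank_write o' ⟨v, hv⟩, hrank_read o hr]
        omega
      · rcases lt_trichotomy (tag o'') (tag o) with h | h | h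
        · exact .inl (hmono o'' hmem'' o' hmem ((hkey_lt _ _).2 (.inl (by rwa [ht])))).le
        · have h1 := hAwrite o'' hmem'' hw''
          rw [h] at h1
          obtain rfl := h1.injective hk hα hN1 hδ ho'
          exact .inl le_rfl
        · exact .inr (hmono o ho o'' hmem'' ((hkey_lt _ _).2 (.inl h)))

end Atomicity

end Execution

end RadonC

/-! ### Atomicity for linear MDS codes -/

theorem theorem5 {F : Type*} [Field F] [Finite F] {n k : ℕ} (hk : 1 ≤ k) (hkn : k ≤ n)
    {ι W R V : Type*} [LinearOrder W] (code : RadonC.LinearMDSCode F n k ι V) (δ : ℕ)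
    (t₀ : RadonC.Tag W) (v₀ : V) (α : ℝ) (hα : (3 * (n : ℝ) + k) / (4 * n) ≤ α)
    (e : RadonC.Execution
      { k := k, δ := δ, Φ := code.encode, t₀ := t₀, v₀ := v₀ : RadonC.Params n W V (ι → F) } R)
    (hN1 : e.N1 α) (hδ : e.ConcurrencyAtMost δ) :
    e.Atomic := by
  exact RadonC.Execution.atomic_of_n1 hk hα hN1 hδ
    fun _ hS _ _ h => code.eq_of_encode_eq hS h
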